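/- **Setting.** A partial function is a map $f:\{0,1\}^n\times\{0,1\}^n\to\{0,1,*\}$, where $*$ means "undefined". Let $\mu$ be a distribution on $\{0,1\}^n\times\{0,1\}^n$; it is a *product distribution* if $\mu(x,y)=\mu_1(x)\mu_2(y)$ for some distributions $\mu_1,\mu_2$, and it is *$\tilde\alpha$-balanced according to $f$* if $\mu(f^{-1}(0)),\mu(f^{-1}(1))\ge\tilde\alpha$. Partial functions $f,g$ are *$\lambda$-close under $\mu$* if $\Pr_{(x,y)\sim\mu}[f(x,y)\ne g(x,y)]\le\lambda$. For $b\in\{0,1\}$ and $\rho\ge 0$, a rectangle $R=A\times B$ is *$\rho$-error $b$-monochromatic* for $g$ under $\mu$ if $\mu(R\cap g^{-1}(1-b))\le\rho\,\mu(R)$. Put $$\mathsf{mono}^\rho_\mu(g)=\min_{b\in\{0,1\}}\ \max_{R}\ \mu(R),\qquad \mathsf{scb}^{\rho,\lambda}_\mu(f)=\max_{g}\ \log_2\frac1{\mathsf{mono}^\rho_\mu(g)},$$ where the first maximum is over the $\rho$-error $b$-monochromatic rectangles $R$ for $g$ under $\mu$, and the second over all partial functions $g$ that are $\lambda$-close to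 $f$ under $\mu$. A *randomized scheme* for the multiphase problem of $f$ with $k\ge1$ inputs, cell size $w\ge1$, update time $t_u$, query time $t_q$ and error probability bounded by $\tilde\varepsilon$ consists of an arbitrary map $E:(\{0,1\}^n)^k\to(\{0,1\}^w)^s$ and of random decision trees $U_y$ ($y\in\{0,1\}^n$) and $Q_i$ ($i\in[k]$) with some joint distribution (independence is allowed but not required). Each possible $U_y$ probes at most $n\,t_u$ of the $s$ cells of $E(x)$ and outputs a sequence in $(\{0,1\}^w)^u$; each possible $Q_i$ makes at most $t_q$ probes into the $s+u$ cells of $(E(x),U_y(E(x)))$ and outputs a bit. It is required that for all $x\in(\{0,1\}^n)^k$, $y\in\{0,1\}^n$, $i\in[k]$ with $f(x_i,y)\ne *$, $$\Pr\bigl[Q_i(E(x),U_y(E(x)))=f(x_i,y)\bigr]\ge 1-\tilde\varepsilon .$$ The scheme is *semi-adaptive* if on every path of every possible $Q_i$ all probes to the cells of $E(x)$ precede all probes to the cells of $U_y(E(x))$. The numbers $s,u$ and the time needed to compute $E$ are unrestricted. **Theorem.** There are absolute constants $c,C>0$, and for all reals $\varepsilon,\alpha$ with $\varepsilon>0$ and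 $\alpha\ge2\varepsilon$ there is a constant $c_1=c_1(\varepsilon,\alpha)>0$, such that the following holds. Let $\lambda,\tilde\varepsilon,\tilde\alpha\ge0$ satisfy $\varepsilon=\tilde\varepsilon+\lambda$ and $\alpha=\tilde\alpha-\lambda$. Let $f$ be a partial function on $\{0,1\}^n\times\{0,1\}^n$ and let $\mu$ be a product distribution that is $\tilde\alpha$-balanced according to $f$. Then every semi-adaptive randomized scheme for the multiphase problem of $f$ with error probability bounded by $\tilde\varepsilon$ satisfies $$t_u\cdot n\ \ge\ c_1\cdot\frac kw\qquad\text{or}\qquad t_q\cdot w\ \ge\ c\cdot\alpha\cdot\mathsf{scb}^{C\varepsilon/\alpha,\,\lambda}_\mu(f).$$ -/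

import Mathlib

noncomputable section

namespace Multiphase

/-! ### Distributions, rectangles and the smooth corruption bound

A partial function `X × Y → {0, 1, *}` is a map `f : X → Y → Option Bool`, where `none` is `*`
(undefined), `some false` is `0` and `some true` is `1`. -/

/-- The probability of the event `S` under the distribution `μ`, as a real number. -/
def prob {Ω : Type} (μ : PMF Ω) (S : Set Ω) : ℝ :=
  (μ.toOuterMeasure S).toReal

/-- `f⁻¹(b)`: the set of inputs where the partial function `f` is defined with value `b`. -/
def fiber {X Y : Type} (f : X → Y → Option Bool) (b : Bool) : Set (X × Y) :=
  {p | f p.1 p.2 = some b}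

/-- `μ` is a product distribution: `μ(x, y) = μ₁(x) · μ₂(y)`. -/
def IsProductDist {X Y : Type} (μ : PMF (X × Y)) : Prop :=
  ∃ (μ₁ : PMF X) (μ₂ : PMF Y), ∀ x y, μ (x, y) = μ₁ x * μ₂ y

/-- `μ` is `α`-balanced according to `f`. -/
def IsBalanced {X Y : Type} (μ : PMF (X × Y)) (f : X → Y → Option Bool) (α : ℝ) : Prop :=
  ∀ b : Bool, α ≤ prob μ (fiber f b)

/-- `f` and `g` are `lam`-close under `μ`: they differ (as maps to `{0, 1, *}`) with probability
at most `lam`. -/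
def IsClose {X Y : Type} (μ : PMF (X × Y)) (lam : ℝ) (f g : X → Y → Option Bool) : Prop :=
  prob μ {p | f p.1 p.2 ≠ g p.1 p.2} ≤ lam

/-- The rectangle `A × B` is `ρ`-error `b`-monochromatic for `f` under `μ`. -/
def IsErrorMonochromatic {X Y : Type} (μ : PMF (X × Y)) (ρ : ℝ) (f : X → Y → Option Bool)
    (b : Bool) (A : Set X) (B : Set Y) : Prop :=
  prob μ ((A ×ˢ B) ∩ fiber f (!b)) ≤ ρ * prob μ (A ×ˢ B)

/-- The largest mass of a `ρ`-error `b`-monochromatic rectangle for `f` under `μ`. -/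
def maxMono {X Y : Type} (μ : PMF (X × Y)) (ρ : ℝ) (f : X → Y → Option Bool) (b : Bool) : ℝ :=
  sSup {m : ℝ | ∃ (A : Set X) (B : Set Y),
    IsErrorMonochromatic μ ρ f b A B ∧ m = prob μ (A ×ˢ B)}

/-- `mono^ρ_μ(f)`. -/
def mono {X Y : Type} (μ : PMF (X × Y)) (ρ : ℝ) (f : X → Y → Option Bool) : ℝ :=
  min (maxMono μ ρ f false) (maxMono μ ρ f true)

/-- The corruption bound `cb^ρ_μ(f) = log₂ (1 / mono^ρ_μ(f))`. (For `ρ ≥ 0`, `mono` is positive as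
soon as both values of `f` have positive mass under `μ`.) -/
def corruptionBound {X Y : Type} (μ : PMF (X × Y)) (ρ : ℝ) (f : X → Y → Option Bool) : ℝ :=
  Real.logb 2 (1 / mono μ ρ f)

/-- The smooth corruption bound `scb^{ρ,lam}_μ(f)`: the maximum of the corruption bounds of all
partial functions that are `lam`-close to `f` under `μ`. -/
def smoothCorruptionBound {X Y : Type} (μ : PMF (X × Y)) (ρ lam : ℝ)
    (f : X → Y → Option Bool) : ℝ :=
  sSup {r : ℝ | ∃ g : X → Y → Option Bool, IsClose μ lam f g ∧ r = corruptionBound μ ρ g}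

/-! ### Cell-probe decision trees -/

/-- The strings in `{0,1}^n`; also the contents `{0,1}^w` of a memory cell. -/
abbrev Bits (n : ℕ) : Type := Fin n → Bool

/-- Decision trees that probe cells with addresses in `A` and contents in `V`, and end with an
output in `O`. -/
inductive DecisionTree (A V O : Type) : Type
  | output (o : O) : DecisionTree A V O
  | probe (a : A) (next : V → DecisionTree A V O) : DecisionTree A V O

namespace DecisionTree

/-- The output of the tree on a given memory. -/
def eval {A V O : Type} (mem : A → V) : DecisionTree A V O → O
  | output o => o
  | probe a next => eval mem (next (mem a))

/-- The largest number of probes on a path of the tree. -/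
def depth {A V O : Type} [Fintype V] : DecisionTree A V O → ℕ
  | output _ => 0
  | probe _ next => 1 + Finset.univ.sup fun v => depth (next v)

/-- The tree probes only cells of the second part of the memory. -/
def OnlySecond {A₁ A₂ V O : Type} : DecisionTree (A₁ ⊕ A₂) V O → Prop
  | output _ => True
  | probe (Sum.inl _) _ => False
  | probe (Sum.inr _) next => ∀ v, OnlySecond (next v)

/-- On every path, all probes to the first part of the memory come before all probes to the second
part. -/
def FirstThenSecond {A₁ A₂ V O : Type} : DecisionTree (A₁ ⊕ A₂) V O → Prop
  | output _ => True
  | probe (Sum.inl _) next => ∀ v, FirstThenSecond (next v)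
  | probe (Sum.inr _) next => ∀ v, OnlySecond (next v)

end DecisionTree

/-! ### Schemes for the multiphase problem -/

/-- A deterministic choice of the update trees `U_y` and the query trees `Q_i`. The memory has `s`
cells of `w` bits, and `u` cells of `w` bits are written in the update phase. -/
structure Trees (n k w s u : ℕ) : Type where
  update : Bits n → DecisionTree (Fin s) (Bits w) (Fin u → Bits w)
  query : Fin k → DecisionTree (Fin s ⊕ Fin u) (Bits w) Bool

/-- The answer `Q_i(M, U_y(M))` on the memory contents `M`. -/
def Trees.answer {n k w s u : ℕ} (T : Trees n k w s u) (M : Fin s → Bits w) (y : Bits n)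
    (i : Fin k) : Bool :=
  (T.query i).eval (Sum.elim M ((T.update y).eval M))

/-- A randomized scheme for the multiphase problem of `f` with update time `tu`, query time `tq` and
error probability at most `err`. The trees are drawn from an arbitrary joint distribution;
independently chosen `U_y` and `Q_i` are the case of a product law, and deterministic schemes are
the case of a point mass. -/
structure RandomizedScheme {n : ℕ} (f : Bits n → Bits n → Option Bool) (k w s u : ℕ)
    (tu tq err : ℝ) : Type where
  /-- The memory contents `E(x)` after the initialization phase. -/
  encode : (Fin k → Bits n) → Fin s → Bits w
  /-- The law of the update and query trees. -/
  law : PMF (Trees n k w s u)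
  update_depth : ∀ T ∈ law.support, ∀ y, ((T.update y).depth : ℝ) ≤ n * tu
  query_depth : ∀ T ∈ law.support, ∀ i, ((T.query i).depth : ℝ) ≤ tq
  correct : ∀ (x : Fin k → Bits n) (y : Bits n) (i : Fin k) (b : Bool), f (x i) y = some b →
    1 - err ≤ prob law {T | T.answer (encode x) y i = b}

/-- The scheme is semi-adaptive: every query tree that may be drawn first probes the cells of `E(x)`
and then the cells written in the update phase. -/
def RandomizedScheme.SemiAdaptive {n : ℕ} {f : Bits n → Bits n → Option Bool} {k w s u : ℕ}
    {tu tq err : ℝ} (D : RandomizedScheme f k w s u tu tq err) : Prop :=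
  ∀ T ∈ D.law.support, ∀ i, (T.query i).FirstThenSecond

end Multiphase

end

open Multiphase

/-! Let x_1, …, x_k be independent with law `μ₁`, let y have law `μ₂`, and fix trees in the support
whose average error is at most that of the scheme. Semi-adaptivity makes the answer to query i a
function of y, of the transcript P_i of its probes to E(x) (at most t_q·w bits, independent of y)
and of the transcript U_y of the update (at most n·t_u·w bits).

If n·t_u·w is far below k, then U_y says little about an average x_i, but it might say more once P_i
is known. So U is revealed greedily at fixed points y_1, …, y_j. Since the x_i are independent, Σ_i
I(x_i : P_i, U_{y_1}, …, U_{y_j}) is at most the number of bits counted, so after few steps a fresh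
U_y gains little on average (`exists_saturated_observations`). For a suitable i, B = (P_i, U_{y_1},
…, U_{y_j}) then carries O(t_q·w) bits on x_i, and by Pinsker x_i and U_y are almost independent
given B.

Under exact conditional independence, the event "B = z and the answer is b" weighs (x, y) by a
product. Its y-factor is at most `μ₂`. Its x-factor is at most M·`μ₁`, with log M = O(t_q·w/α), up
to a part of small mass. A bilinear form on such weights is maximal at vertices, so a true rectangle
does at least as well (`exists_rectangle_of_predictor`). Testing with η − 1[g = 1−b], η = 16ε/α,
produces an η-error b-monochromatic rectangle of mass at least α/(32M), for both b and every g that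
is λ-close to f. -/

noncomputable section

namespace FiniteInfo

open Finset

variable {Ω α β γ : Type*} [Fintype Ω]

/-! ### Marginals of a weight function on a finite set -/

open Classical in
/-- The weight of the event `A = a`. -/
def marginal (ρ : Ω → ℝ) (A : Ω → α) (a : α) : ℝ :=
  ∑ ω, if A ω = a then ρ ω else 0

theorem marginal_nonneg {ρ : Ω → ℝ} (h : ∀ ω, 0 ≤ ρ ω) (A : Ω → α) (a : α) :
    0 ≤ marginal ρ A a :=
  sum_nonneg fun ω _ => by split_ifs <;> simp [h]

theorem le_marginal {ρ : Ω → ℝ} (h : ∀ ω, 0 ≤ ρ ω) (A : Ω → α) (ω : Ω) :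
    ρ ω ≤ marginal ρ A (A ω) := by
  classical
  have := single_le_sum (f := fun ω' => if A ω' = A ω then ρ ω' else 0)
    (fun ω' _ => by split_ifs <;> simp [h]) (mem_univ ω)
  simpa [marginal] using this

theorem marginal_pos {ρ : Ω → ℝ} (h : ∀ ω, 0 ≤ ρ ω) (A : Ω → α) {ω : Ω} (hω : 0 < ρ ω) :
    0 < marginal ρ A (A ω) :=
  hω.trans_le (le_marginal h A ω)

theorem sum_marginal_mul [Fintype α] (ρ : Ω → ℝ) (A : Ω → α) (φ : α → ℝ) :
    ∑ a, marginal ρ A a * φ a = ∑ ω, ρ ω * φ (A ω) := by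
  classical
  simp only [marginal, sum_mul]
  rw [sum_comm]
  refine sum_congr rfl fun ω _ => ?_
  simp [ite_mul]

theorem sum_marginal [Fintype α] (ρ : Ω → ℝ) (A : Ω → α) :
    ∑ a, marginal ρ A a = ∑ ω, ρ ω := by
  simpa using sum_marginal_mul ρ A fun _ => 1

theorem sum_marginal_pair_right [Fintype β] (ρ : Ω → ℝ) (A : Ω → α) (B : Ω → β) (a : α) :
    ∑ b, marginal ρ (fun ω => (A ω, B ω)) (a, b) = marginal ρ A a := by
  classical
  simp only [marginal]
  rw [sum_comm]
  refine sum_congr rfl fun ω _ => ?_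
  by_cases h : A ω = a <;> simp [h]

theorem sum_marginal_pair_left [Fintype α] (ρ : Ω → ℝ) (A : Ω → α) (B : Ω → β) (b : β) :
    ∑ a, marginal ρ (fun ω => (A ω, B ω)) (a, b) = marginal ρ B b := by
  classical
  simp only [marginal]
  rw [sum_comm]
  refine sum_congr rfl fun ω _ => ?_
  by_cases h : B ω = b <;> simp [h]

theorem marginal_pair_le_right {ρ : Ω → ℝ} (h : ∀ ω, 0 ≤ ρ ω) (A : Ω → α) (B : Ω → β)
    (a : α) (b : β) : marginal ρ (fun ω => (A ω, B ω)) (a, b) ≤ marginal ρ B b := by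
  classical
  refine sum_le_sum fun ω _ => ?_
  by_cases h1 : A ω = a <;> by_cases h2 : B ω = b <;> simp [h1, h2, h]

theorem marginal_pair_le_left {ρ : Ω → ℝ} (h : ∀ ω, 0 ≤ ρ ω) (A : Ω → α) (B : Ω → β)
    (a : α) (b : β) : marginal ρ (fun ω => (A ω, B ω)) (a, b) ≤ marginal ρ A a := by
  classical
  refine sum_le_sum fun ω _ => ?_
  by_cases h1 : A ω = a <;> by_cases h2 : B ω = b <;> simp [h1, h2, h]

theorem marginal_congr {ρ : Ω → ℝ} {A : Ω → α} {B : Ω → β}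
    (h : ∀ ω ω', A ω = A ω' ↔ B ω = B ω') (ω : Ω) :
    marginal ρ A (A ω) = marginal ρ B (B ω) := by
  classical
  simp only [marginal, h]

/-! ### Logarithmic inequalities -/

/-- Jensen's inequality for the logarithm, by its tangent at N. -/
theorem sum_mul_log_le {ρ F : Ω → ℝ} (h : ∀ ω, 0 ≤ ρ ω) (h1 : ∑ ω, ρ ω = 1)
    (hF : ∀ ω, 0 < ρ ω → 0 < F ω) {N : ℝ} (hN : 0 < N) (hFN : ∑ ω, ρ ω * F ω ≤ N) :
    ∑ ω, ρ ω * Real.log (F ω) ≤ Real.log N := by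
  have key : ∀ ω, ρ ω * Real.log (F ω) ≤ ρ ω * F ω / N + ρ ω * (Real.log N - 1) := by
    intro ω
    rcases (h ω).eq_or_lt with h0 | h0
    · simp [← h0]
    have := Real.log_le_sub_one_of_pos (div_pos (hF ω h0) hN)
    rw [Real.log_div (hF ω h0).ne' hN.ne'] at this
    have := mul_le_mul_of_nonneg_left this h0.le
    rw [mul_div_assoc]
    linarith
  calc ∑ ω, ρ ω * Real.log (F ω) ≤ ∑ ω, (ρ ω * F ω / N + ρ ω * (Real.log N - 1)) :=
        sum_le_sum fun ω _ => key ω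
    _ = (∑ ω, ρ ω * F ω) / N + (Real.log N - 1) := by
        rw [sum_add_distrib, ← sum_div, ← sum_mul, h1, one_mul]
    _ ≤ 1 + (Real.log N - 1) := by gcongr; exact (div_le_one hN).2 hFN
    _ = Real.log N := by ring

/-- A Pinsker inequality, with a constant that comes from the Hellinger distance. -/
theorem sq_sum_abs_sub_le {ι : Type*} [Fintype ι] {p q : ι → ℝ} (hp : ∀ i, 0 ≤ p i)
    (hq : ∀ i, 0 ≤ q i) (hpq : ∀ i, 0 < p i → 0 < q i) (hp1 : ∑ i, p i = 1)
    (hq1 : ∑ i, q i ≤ 1) :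
    (∑ i, |p i - q i|) ^ 2 ≤ 4 * ∑ i, p i * Real.log (p i / q i) := by
  -- Apply log t ≤ t − 1 at t = √(q/p). On summation p − q contributes at least 0, as q has mass at
  -- most 1, and the squared Hellinger distance remains.
  have term : ∀ i, p i - q i + (√(p i) - √(q i)) ^ 2 ≤ p i * Real.log (p i / q i) := by
    intro i
    have e : p i - q i + (√(p i) - √(q i)) ^ 2 = 2 * p i - 2 * (√(p i) * √(q i)) := by
      have h1 := Real.sq_sqrt (hp i)
      have h2 := Real.sq_sqrt (hq i)
      linear_combination h1 + h2
    rw [e]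
    rcases (hp i).eq_or_lt with h0 | h0
    · simp [← h0]
    have hqi := hpq i h0
    have hl : Real.log (√(q i / p i)) ≤ √(q i / p i) - 1 :=
      Real.log_le_sub_one_of_pos (Real.sqrt_pos.2 (div_pos hqi h0))
    rw [Real.log_sqrt (div_pos hqi h0).le, Real.log_div hqi.ne' h0.ne'] at hl
    rw [Real.log_div h0.ne' hqi.ne']
    have hs : p i * √(q i / p i) = √(p i) * √(q i) := by
      rw [Real.sqrt_div hqi.le]
      nth_rw 1 [← Real.mul_self_sqrt h0.le]
      have := (Real.sqrt_pos.2 h0).ne'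
      field_simp
    have := mul_le_mul_of_nonneg_left hl h0.le
    rw [mul_sub, hs] at this
    linarith
  have hell : ∑ i, (√(p i) - √(q i)) ^ 2 ≤ ∑ i, p i * Real.log (p i / q i) := by
    have := sum_le_sum fun i (_ : i ∈ (univ : Finset ι)) => term i
    rw [sum_add_distrib, sum_sub_distrib] at this
    linarith
  have hplus : ∑ i, (√(p i) + √(q i)) ^ 2 ≤ 4 := by
    calc ∑ i, (√(p i) + √(q i)) ^ 2 ≤ ∑ i, 2 * (p i + q i) := by
          refine sum_le_sum fun i _ => ?_
          have h1 := Real.sq_sqrt (hp i)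
          have h2 := Real.sq_sqrt (hq i)
          nlinarith [sq_nonneg (√(p i) - √(q i))]
      _ ≤ 4 := by rw [← mul_sum, sum_add_distrib]; linarith
  have hfac : ∀ i, |p i - q i| = |√(p i) - √(q i)| * (√(p i) + √(q i)) := by
    intro i
    rw [← abs_of_nonneg (add_nonneg (Real.sqrt_nonneg (p i)) (Real.sqrt_nonneg (q i))), ← abs_mul]
    congr 1
    have h1 := Real.sq_sqrt (hp i)
    have h2 := Real.sq_sqrt (hq i)
    linear_combination h2 - h1
  have cs := sum_mul_sq_le_sq_mul_sq univ (fun i => |√(p i) - √(q i)|)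
    (fun i => √(p i) + √(q i))
  simp only [sq_abs] at cs
  simp only [hfac]
  have h0 : 0 ≤ ∑ i, (√(p i) - √(q i)) ^ 2 := sum_nonneg fun i _ => sq_nonneg _
  nlinarith

open Classical in
/-- Markov's inequality for the likelihood ratio. -/
theorem sum_ite_mul_log_le {ι : Type*} [Fintype ι] {p q : ι → ℝ} (hp : ∀ i, 0 ≤ p i)
    (hq : ∀ i, 0 ≤ q i) (hpq : ∀ i, 0 < p i → 0 < q i) (hq1 : ∑ i, q i ≤ 1) {M : ℝ}
    (hM : 0 < M) :
    (∑ i, if M * q i < p i then p i else 0) * Real.log M ≤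
      ∑ i, p i * Real.log (p i / q i) + 1 := by
  -- Off the tail, p log(p/q) ≥ p − q ≥ −q, so the negative part of the divergence costs at most the
  -- mass of q.
  have term : ∀ i, (if M * q i < p i then p i else 0) * Real.log M ≤
      p i * Real.log (p i / q i) + q i := by
    intro i
    rcases (hp i).eq_or_lt with h0 | h0
    · simp [← h0, hq]
    have hqi := hpq i h0
    split_ifs with h
    · have : Real.log M ≤ Real.log (p i / q i) := by
        apply Real.log_le_log hM
        rw [le_div_iff₀ hqi]
        exact h.le
      nlinarith [hq i]
    · have := Real.log_le_sub_one_of_pos (div_pos hqi h0)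
      have h2 := mul_le_mul_of_nonneg_left this h0.le
      rw [mul_sub, mul_div_cancel₀ _ h0.ne', ← inv_div, Real.log_inv] at h2
      linarith
  calc _ = ∑ i, (if M * q i < p i then p i else 0) * Real.log M := sum_mul _ _ _
    _ ≤ ∑ i, (p i * Real.log (p i / q i) + q i) := sum_le_sum fun i _ => term i
    _ ≤ _ := by rw [sum_add_distrib]; linarith

/-! ### Mutual information -/

/-- The mutual information `I(A : B)` (in nats). -/
def mutualInfo (ρ : Ω → ℝ) (A : Ω → α) (B : Ω → β) : ℝ :=
  ∑ ω, ρ ω * Real.log (marginal ρ (fun ω => (A ω, B ω)) (A ω, B ω) /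
    (marginal ρ A (A ω) * marginal ρ B (B ω)))

theorem mutualInfo_congr_right {ρ : Ω → ℝ} (A : Ω → α) {B : Ω → β} {B' : Ω → γ}
    (h : ∀ ω ω', B ω = B ω' ↔ B' ω = B' ω') : mutualInfo ρ A B = mutualInfo ρ A B' := by
  refine sum_congr rfl fun ω _ => ?_
  rw [marginal_congr h ω, marginal_congr (A := fun ω => (A ω, B ω)) (B := fun ω => (A ω, B' ω))
    (by intro ω ω'; simp [h]) ω]

theorem mutualInfo_eq_sum [Fintype α] [Fintype β] (ρ : Ω → ℝ) (A : Ω → α) (B : Ω → β) :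
    mutualInfo ρ A B = ∑ s : α × β, marginal ρ (fun ω => (A ω, B ω)) s *
      Real.log (marginal ρ (fun ω => (A ω, B ω)) s / (marginal ρ A s.1 * marginal ρ B s.2)) := by
  rw [sum_marginal_mul ρ (fun ω => (A ω, B ω)) fun s => Real.log
    (marginal ρ (fun ω => (A ω, B ω)) s / (marginal ρ A s.1 * marginal ρ B s.2))]
  rfl

/-- The gain is at most the conditional entropy H(C | B): dropping C from the joint law in the
numerator only enlarges the ratio. Jensen bounds this entropy by the logarithm of the number of
values. -/
theorem mutualInfo_pair_le_add [Fintype β] [Fintype γ] [Nonempty γ] {ρ : Ω → ℝ}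
    (h : ∀ ω, 0 ≤ ρ ω) (h1 : ∑ ω, ρ ω = 1) (A : Ω → α) (B : Ω → β) (C : Ω → γ) :
    mutualInfo ρ A (fun ω => (C ω, B ω)) ≤
      mutualInfo ρ A B + Real.log (Fintype.card γ) := by
  have hle : mutualInfo ρ A (fun ω => (C ω, B ω)) ≤ mutualInfo ρ A B +
      ∑ ω, ρ ω * Real.log (marginal ρ B (B ω) /
        marginal ρ (fun ω => (C ω, B ω)) (C ω, B ω)) := by
    rw [mutualInfo, mutualInfo, ← sum_add_distrib]
    refine sum_le_sum fun ω _ => ?_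
    rcases (h ω).eq_or_lt with h0 | h0
    · simp [← h0]
    rw [← mul_add]
    refine mul_le_mul_of_nonneg_left ?_ h0.le
    have p1 := marginal_pos h (fun ω => (A ω, C ω, B ω)) h0
    have p2 := marginal_pos h (fun ω => (C ω, B ω)) h0
    have p3 := marginal_pos h (fun ω => (A ω, B ω)) h0
    have p4 := marginal_pos h A h0
    have p5 := marginal_pos h B h0
    have hm : marginal ρ (fun ω => (A ω, C ω, B ω)) (A ω, C ω, B ω) ≤
        marginal ρ (fun ω => (A ω, B ω)) (A ω, B ω) := by
      rw [marginal_congr (B := fun ω => (C ω, (A ω, B ω)))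
        (by intro ω ω'; simp only [Prod.mk.injEq]; tauto) ω]
      exact marginal_pair_le_right h C (fun ω => (A ω, B ω)) _ _
    rw [← Real.log_mul (by positivity) (by positivity)]
    apply Real.log_le_log (by positivity)
    calc _ ≤ marginal ρ (fun ω => (A ω, B ω)) (A ω, B ω) / (marginal ρ A (A ω) *
          marginal ρ (fun ω => (C ω, B ω)) (C ω, B ω)) := by gcongr
      _ = _ := by field_simp
  refine hle.trans (add_le_add le_rfl ?_)
  refine sum_mul_log_le h h1 (fun ω h0 => div_pos (marginal_pos h B h0)
    (marginal_pos h (fun ω => (C ω, B ω)) h0)) (by exact_mod_cast Fintype.card_pos) ?_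
  rw [← sum_marginal_mul ρ (fun ω => (C ω, B ω)) fun s => marginal ρ B s.2 /
    marginal ρ (fun ω => (C ω, B ω)) s]
  calc _ ≤ ∑ s : γ × β, marginal ρ B s.2 := by
        refine sum_le_sum fun s _ => ?_
        have := marginal_nonneg h B s.2
        by_cases h0 : marginal ρ (fun ω => (C ω, B ω)) s = 0
        · simp [h0, this]
        · rw [mul_div_cancel₀ _ h0]
    _ = _ := by
        rw [Fintype.sum_prod_type]
        simp [sum_marginal, h1]

/-- Independent coordinates share the information in `V`. Instead of a chain rule, Jensen is applied
to the product over i of the likelihood ratios P(ω_i | V) / P(ω_i), whose expectation is at most the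
number of values of `V`. -/
theorem sum_mutualInfo_eval_le {ι : Type*} [Fintype ι] [DecidableEq ι] [Fintype α] [Fintype γ] [Nonempty γ]
    {a : ι → α → ℝ} (ha : ∀ i x, 0 ≤ a i x) {ρ : (ι → α) → ℝ} (hρ : ∀ ω, ρ ω = ∏ i, a i (ω i))
    (h1 : ∑ ω, ρ ω = 1) (hm : ∀ i x, marginal ρ (fun ω => ω i) x = a i x) (V : (ι → α) → γ) :
    ∑ i, mutualInfo ρ (fun ω => ω i) V ≤ Real.log (Fintype.card γ) := by
  classical
  have h : ∀ ω, 0 ≤ ρ ω := fun ω => by rw [hρ]; exact prod_nonneg fun i _ => ha i _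
  let R : ι → α → γ → ℝ := fun i x v => marginal ρ (fun ω => (ω i, V ω)) (x, v) / marginal ρ V v
  have hR : ∀ i x v, 0 ≤ R i x v := fun i x v =>
    div_nonneg (marginal_nonneg h _ _) (marginal_nonneg h _ _)
  let F : (ι → α) → ℝ := fun ω => ∏ i, (R i (ω i) (V ω) / a i (ω i))
  have hpos : ∀ ω, 0 < ρ ω → ∀ i, 0 < R i (ω i) (V ω) / a i (ω i) := by
    intro ω h0 i
    refine div_pos (div_pos (marginal_pos h (fun ω => (ω i, V ω)) h0) (marginal_pos h V h0)) ?_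
    rw [← hm]
    exact marginal_pos h (fun ω => ω i) h0
  have e : ∑ i, mutualInfo ρ (fun ω => ω i) V = ∑ ω, ρ ω * Real.log (F ω) := by
    simp only [mutualInfo]
    rw [sum_comm]
    refine sum_congr rfl fun ω _ => ?_
    rcases (h ω).eq_or_lt with h0 | h0
    · simp [← h0]
    rw [← mul_sum, Real.log_prod fun i _ => (hpos ω h0 i).ne']
    simp only [hm, R, div_div, mul_comm]
  rw [e]
  refine sum_mul_log_le h h1 (fun ω h0 => prod_pos fun i _ => hpos ω h0 i)
    (by exact_mod_cast Fintype.card_pos) ?_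
  calc ∑ ω, ρ ω * F ω ≤ ∑ ω, ∏ i, R i (ω i) (V ω) := by
        refine sum_le_sum fun ω _ => ?_
        rw [hρ, ← prod_mul_distrib]
        refine prod_le_prod (fun i _ => mul_nonneg (ha i _) (div_nonneg (hR i _ _) (ha i _)))
          fun i _ => ?_
        by_cases h0 : a i (ω i) = 0
        · simp [h0, hR]
        · rw [mul_div_cancel₀ _ h0]
    -- Allowing every v decouples it from ω, and the sum over ω factors over the coordinates.
    _ ≤ ∑ ω : ι → α, ∑ v, ∏ i, R i (ω i) v := by
        refine sum_le_sum fun ω _ => ?_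
        exact single_le_sum (f := fun v => ∏ i, R i (ω i) v)
          (fun v _ => prod_nonneg fun i _ => hR i _ _) (mem_univ (V ω))
    _ = ∑ v, ∏ i, ∑ x, R i x v := by
        rw [sum_comm]
        refine sum_congr rfl fun v _ => ?_
        rw [prod_univ_sum, Fintype.piFinset_univ]
    _ ≤ ∑ v : γ, 1 := by
        refine sum_le_sum fun v _ => ?_
        refine prod_le_one (fun i _ => sum_nonneg fun x _ => hR i x v) fun i _ => ?_
        simp only [R, ← sum_div, sum_marginal_pair_left]
        exact div_self_le_one _
    _ = Fintype.card γ := by simp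

theorem mutualInfo_nonneg [Fintype α] [Fintype β] {ρ : Ω → ℝ} (h : ∀ ω, 0 ≤ ρ ω)
    (h1 : ∑ ω, ρ ω = 1) (A : Ω → α) (B : Ω → β) : 0 ≤ mutualInfo ρ A B := by
  have := sq_sum_abs_sub_le (p := marginal ρ (fun ω => (A ω, B ω)))
    (q := fun s : α × β => marginal ρ A s.1 * marginal ρ B s.2) (marginal_nonneg h _)
    (fun s => mul_nonneg (marginal_nonneg h _ _) (marginal_nonneg h _ _))
    (fun s hs => mul_pos (hs.trans_le (marginal_pair_le_left h A B _ _))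
      (hs.trans_le (marginal_pair_le_right h A B _ _)))
    (by rw [sum_marginal, h1])
    (by rw [Fintype.sum_prod_type]; simp [← mul_sum, sum_marginal, h1])
  rw [← mutualInfo_eq_sum] at this
  nlinarith [sq_nonneg (∑ s : α × β, |marginal ρ (fun ω => (A ω, B ω)) s -
    marginal ρ A s.1 * marginal ρ B s.2|)]

open Classical in
theorem sum_ite_marginal_mul_log_le [Fintype α] [Fintype β] {ρ : Ω → ℝ} (h : ∀ ω, 0 ≤ ρ ω)
    (h1 : ∑ ω, ρ ω = 1) (A : Ω → α) (B : Ω → β) {M : ℝ} (hM : 0 < M) :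
    (∑ s : α × β, if M * (marginal ρ A s.1 * marginal ρ B s.2) <
      marginal ρ (fun ω => (A ω, B ω)) s then marginal ρ (fun ω => (A ω, B ω)) s else 0) *
      Real.log M ≤ mutualInfo ρ A B + 1 := by
  have := sum_ite_mul_log_le (p := marginal ρ (fun ω => (A ω, B ω)))
    (q := fun s : α × β => marginal ρ A s.1 * marginal ρ B s.2) (marginal_nonneg h _)
    (fun s => mul_nonneg (marginal_nonneg h _ _) (marginal_nonneg h _ _))
    (fun s hs => mul_pos (hs.trans_le (marginal_pair_le_left h A B _ _))
      (hs.trans_le (marginal_pair_le_right h A B _ _)))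
    (by rw [Fintype.sum_prod_type]; simp [← mul_sum, sum_marginal, h1]) hM
  rwa [← mutualInfo_eq_sum] at this

/-- If `C` adds little information on `A` to `B`, then `A` and `C` are almost independent
given `B`. -/
theorem sq_sum_abs_marginal_sub_le [Fintype α] [Fintype β] [Fintype γ] {ρ : Ω → ℝ}
    (h : ∀ ω, 0 ≤ ρ ω) (h1 : ∑ ω, ρ ω = 1) (A : Ω → α) (B : Ω → β) (C : Ω → γ) :
    (∑ s : α × β × γ, |marginal ρ (fun ω => (A ω, B ω, C ω)) s -
      marginal ρ (fun ω => (A ω, B ω)) (s.1, s.2.1) *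
        marginal ρ (fun ω => (B ω, C ω)) s.2 / marginal ρ B s.2.1|) ^ 2 ≤
    4 * (mutualInfo ρ A (fun ω => (B ω, C ω)) - mutualInfo ρ A B) := by
  have hle : ∀ s : α × β × γ, marginal ρ (fun ω => (A ω, B ω, C ω)) s ≤
      marginal ρ (fun ω => (A ω, B ω)) (s.1, s.2.1) := by
    rintro ⟨a, b, c⟩
    rw [← sum_marginal_pair_right ρ (fun ω => (A ω, B ω)) C]
    have : ∀ c', marginal ρ (fun ω => ((A ω, B ω), C ω)) ((a, b), c') =
        marginal ρ (fun ω => (A ω, B ω, C ω)) (a, b, c') := by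
      classical
      intro c'
      refine sum_congr rfl fun ω _ => ?_
      by_cases h1 : A ω = a <;> by_cases h2 : B ω = b <;> simp [h1, h2]
    rw [← this]
    exact single_le_sum (f := fun c => marginal ρ (fun ω => ((A ω, B ω), C ω)) ((a, b), c))
      (fun c' _ => marginal_nonneg h _ _) (mem_univ c)
  refine (sq_sum_abs_sub_le (marginal_nonneg h _)
    (fun s => div_nonneg (mul_nonneg (marginal_nonneg h _ _) (marginal_nonneg h _ _))
      (marginal_nonneg h _ _)) (fun s hs => ?_) (by rw [sum_marginal, h1]) ?_).trans_eq ?_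
  · have h2 := hs.trans_le (marginal_pair_le_right h A (fun ω => (B ω, C ω)) s.1 s.2)
    exact div_pos (mul_pos (hs.trans_le (hle s)) h2)
      (h2.trans_le (marginal_pair_le_left h B C _ _))
  · rw [Fintype.sum_prod_type_right]
    simp only [mul_div_assoc, ← sum_mul]
    calc _ ≤ ∑ s : β × γ, marginal ρ (fun ω => (B ω, C ω)) s := by
          refine sum_le_sum fun s _ => ?_
          rw [sum_marginal_pair_left]
          have := marginal_nonneg h (fun ω => (B ω, C ω)) s
          by_cases h0 : marginal ρ B s.1 = 0
          · simp [h0, this]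
          · rw [mul_div_cancel₀ _ h0]
      _ ≤ 1 := by rw [sum_marginal, h1]
  -- The divergence from the conditionally independent law is I(A : C | B); the chain rule holds
  -- pointwise for the logarithms.
  · rw [sum_marginal_mul ρ (fun ω => (A ω, B ω, C ω)) fun s =>
      Real.log (marginal ρ (fun ω => (A ω, B ω, C ω)) s /
      (marginal ρ (fun ω => (A ω, B ω)) (s.1, s.2.1) *
        marginal ρ (fun ω => (B ω, C ω)) s.2 / marginal ρ B s.2.1))]
    rw [mutualInfo, mutualInfo, ← sum_sub_distrib]
    congr 1
    refine sum_congr rfl fun ω _ => ?_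
    rcases (h ω).eq_or_lt with h0 | h0
    · simp [← h0]
    have p1 := (marginal_pos h (fun ω => (A ω, B ω, C ω)) h0).ne'
    have p2 := (marginal_pos h (fun ω => (B ω, C ω)) h0).ne'
    have p3 := (marginal_pos h (fun ω => (A ω, B ω)) h0).ne'
    have p4 := (marginal_pos h A h0).ne'
    have p5 := (marginal_pos h B h0).ne'
    rw [← mul_sub, ← Real.log_div (by simp [p1, p2, p4]) (by simp [p3, p4, p5])]
    congr 2
    field_simp

/-! ### From almost independent variables to rectangles -/

open Classical in
theorem sum_mul_le_sum_ite {ι : Type*} [Fintype ι] {a m : ι → ℝ} (ha : ∀ i, 0 ≤ a i)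
    (ham : ∀ i, a i ≤ m i) (φ : ι → ℝ) :
    ∑ i, a i * φ i ≤ ∑ i, (if 0 ≤ φ i then m i else 0) * φ i := by
  refine sum_le_sum fun i _ => ?_
  split_ifs with h
  · exact mul_le_mul_of_nonneg_right (ham i) h
  · rw [zero_mul]
    exact mul_nonpos_of_nonneg_of_nonpos (ha i) (not_le.1 h).le

open Classical in
/-- A bilinear form on a product of boxes is maximal at a pair of vertices. -/
theorem exists_rectangle_le {X Y : Type*} [Fintype X] [Fintype Y] {a m : X → ℝ} {w n : Y → ℝ}
    (ha : ∀ x, 0 ≤ a x) (ham : ∀ x, a x ≤ m x) (hw : ∀ y, 0 ≤ w y) (hwn : ∀ y, w y ≤ n y)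
    (c : X → Y → ℝ) :
    ∃ (A : Set X) (B : Set Y), ∑ x, ∑ y, a x * w y * c x y ≤
      ∑ x, ∑ y, if x ∈ A ∧ y ∈ B then m x * n y * c x y else 0 := by
  let A : Set X := {x | 0 ≤ ∑ y, w y * c x y}
  let B : Set Y := {y | 0 ≤ ∑ x, (if x ∈ A then m x else 0) * c x y}
  refine ⟨A, B, ?_⟩
  calc ∑ x, ∑ y, a x * w y * c x y = ∑ x, a x * ∑ y, w y * c x y := by
        simp only [mul_sum, mul_assoc]
    _ ≤ ∑ x, (if x ∈ A then m x else 0) * ∑ y, w y * c x y :=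
        sum_mul_le_sum_ite ha ham _
    _ = ∑ y, w y * ∑ x, (if x ∈ A then m x else 0) * c x y := by
        simp only [mul_sum]
        rw [sum_comm]
        exact sum_congr rfl fun y _ => sum_congr rfl fun x _ => by ring
    _ ≤ ∑ y, (if y ∈ B then n y else 0) * ∑ x, (if x ∈ A then m x else 0) * c x y :=
        sum_mul_le_sum_ite hw hwn _
    _ = _ := by
        simp only [mul_sum]
        rw [sum_comm]
        refine sum_congr rfl fun x _ => sum_congr rfl fun y _ => ?_
        by_cases hx : x ∈ A <;> by_cases hy : y ∈ B <;> simp [hx, hy]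
        ring

variable {Ω α β γ υ : Type*} [Fintype Ω] [Fintype α] [Fintype β] [Fintype γ] [Fintype υ]

/-- Averaged over `y`, replacing the joint law of `(A, B, C y)` by the law in which `A` and `C y`
are independent given `B` changes bounded expectations little. -/
theorem sum_mul_le_sum_condIndep {ρ : Ω → ℝ} (h : ∀ ω, 0 ≤ ρ ω) (h1 : ∑ ω, ρ ω = 1)
    {ν : υ → ℝ} (hν : ∀ y, 0 ≤ ν y) (hν1 : ∑ y, ν y = 1)
    (A : Ω → α) (B : Ω → β) (C : υ → Ω → γ) {τ K : ℝ} (hτ : 0 < τ) (hK : 0 ≤ K)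
    (hJ : 4 * ∑ y, ν y * (mutualInfo ρ A (fun ω => (B ω, C y ω)) - mutualInfo ρ A B) ≤ τ ^ 2)
    (φ : υ → α × β × γ → ℝ) (hφ : ∀ y s, |φ y s| ≤ K) :
    ∑ y, ν y * ∑ ω, ρ ω * φ y (A ω, B ω, C y ω) ≤
      ∑ y, ν y * (∑ s : α × β × γ, marginal ρ (fun ω => (A ω, B ω)) (s.1, s.2.1) *
        marginal ρ (fun ω => (B ω, C y ω)) s.2 / marginal ρ B s.2.1 * φ y s) + K * τ := by
  let D : υ → ℝ := fun y => ∑ s : α × β × γ, |marginal ρ (fun ω => (A ω, B ω, C y ω)) s -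
      marginal ρ (fun ω => (A ω, B ω)) (s.1, s.2.1) *
        marginal ρ (fun ω => (B ω, C y ω)) s.2 / marginal ρ B s.2.1|
  have hD : ∑ y, ν y * D y ≤ τ := by
    have hsq : ∑ y, ν y * D y ^ 2 ≤ τ ^ 2 := by
      refine le_trans ?_ hJ
      rw [mul_sum]
      refine sum_le_sum fun y _ => ?_
      have := mul_le_mul_of_nonneg_left (sq_sum_abs_marginal_sub_le h h1 A B (C y)) (hν y)
      linarith
    -- From the second to the first moment by 2τD ≤ D² + τ².
    have h2 : 2 * τ * ∑ y, ν y * D y ≤ ∑ y, ν y * D y ^ 2 + τ ^ 2 := by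
      calc 2 * τ * ∑ y, ν y * D y = ∑ y, ν y * (2 * τ * D y) := by
            rw [mul_sum]; exact sum_congr rfl fun y _ => by ring
        _ ≤ ∑ y, ν y * (D y ^ 2 + τ ^ 2) := by
            refine sum_le_sum fun y _ => mul_le_mul_of_nonneg_left ?_ (hν y)
            nlinarith [sq_nonneg (D y - τ)]
        _ = _ := by simp only [mul_add, sum_add_distrib, ← sum_mul, hν1, one_mul]
    nlinarith
  have hy : ∀ y, ∑ ω, ρ ω * φ y (A ω, B ω, C y ω) ≤
      (∑ s : α × β × γ, marginal ρ (fun ω => (A ω, B ω)) (s.1, s.2.1) *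
        marginal ρ (fun ω => (B ω, C y ω)) s.2 / marginal ρ B s.2.1 * φ y s) + K * D y := by
    intro y
    rw [← sum_marginal_mul ρ (fun ω => (A ω, B ω, C y ω)), mul_sum, ← sum_add_distrib]
    refine sum_le_sum fun s _ => ?_
    rw [← sub_le_iff_le_add', ← sub_mul, mul_comm K]
    refine (le_abs_self _).trans ?_
    rw [abs_mul]
    exact mul_le_mul_of_nonneg_left (hφ y s) (abs_nonneg _)
  calc _ ≤ ∑ y, ν y * ((∑ s : α × β × γ, marginal ρ (fun ω => (A ω, B ω)) (s.1, s.2.1) *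
        marginal ρ (fun ω => (B ω, C y ω)) s.2 / marginal ρ B s.2.1 * φ y s) + K * D y) :=
        sum_le_sum fun y _ => mul_le_mul_of_nonneg_left (hy y) (hν y)
    _ = ∑ y, ν y * (∑ s : α × β × γ, marginal ρ (fun ω => (A ω, B ω)) (s.1, s.2.1) *
        marginal ρ (fun ω => (B ω, C y ω)) s.2 / marginal ρ B s.2.1 * φ y s) +
        K * ∑ y, ν y * D y := by
        rw [mul_sum (a := K), ← sum_add_distrib]
        exact sum_congr rfl fun y _ => by ring
    _ ≤ _ := by gcongr

open Classical in
/-- If the output `t (B, y, C y)` predicts the sign of `c (A, y)` well, `B` carries little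
information on `A`, and `C y` adds almost nothing, then `c` is biased on a large rectangle. -/
theorem exists_rectangle_of_predictor {ρ : Ω → ℝ} (h : ∀ ω, 0 ≤ ρ ω) (h1 : ∑ ω, ρ ω = 1)
    {ν : υ → ℝ} (hν : ∀ y, 0 ≤ ν y) (hν1 : ∑ y, ν y = 1)
    (A : Ω → α) (B : Ω → β) (C : υ → Ω → γ) {τ K η M κ δ : ℝ} (hτ : 0 < τ) (hK : 0 ≤ K) (hM : 1 < M)
    (hJ : 4 * ∑ y, ν y * (mutualInfo ρ A (fun ω => (B ω, C y ω)) - mutualInfo ρ A B) ≤ τ ^ 2)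
    (hI : mutualInfo ρ A B + 1 ≤ κ * Real.log M)
    (t : β → υ → γ → Prop) (c : α → υ → ℝ) (hc : ∀ x y, |c x y| ≤ K) (hcη : ∀ x y, c x y ≤ η)
    (hη : 0 ≤ η)
    (hδ : δ + K * τ + η * κ <
      ∑ y, ν y * ∑ ω, ρ ω * if t (B ω) y (C y ω) then c (A ω) y else 0) :
    ∃ (S : Set α) (T : Set υ), δ ≤
      M * ∑ x, ∑ y, if x ∈ S ∧ y ∈ T then marginal ρ A x * ν y * c x y else 0 := by
  let r : α → β → ℝ := fun x z => marginal ρ (fun ω => (A ω, B ω)) (x, z)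
  let R : υ → β → γ → ℝ := fun y z v => marginal ρ (fun ω => (B ω, C y ω)) (z, v) / marginal ρ B z
  -- Split the law of (A, B) at likelihood ratio M: `good` is at most M times the product of the
  -- marginals, and `bad` has mass at most κ.
  let good : α → β → ℝ := fun x z =>
    if M * (marginal ρ A x * marginal ρ B z) < r x z then 0 else r x z
  let bad : α → β → ℝ := fun x z =>
    if M * (marginal ρ A x * marginal ρ B z) < r x z then r x z else 0
  let φ : υ → α × β × γ → ℝ := fun y s => if t s.2.1 y s.2.2 then c s.1 y else 0
  have hr : ∀ x z, 0 ≤ r x z := fun x z => marginal_nonneg h _ _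
  have hR : ∀ y z v, 0 ≤ R y z v := fun y z v =>
    div_nonneg (marginal_nonneg h _ _) (marginal_nonneg h _ _)
  have hR1 : ∀ y z, ∑ v, R y z v ≤ 1 := fun y z => by
    simp only [R, ← sum_div, sum_marginal_pair_right]
    exact div_self_le_one _
  have hφK : ∀ y s, |φ y s| ≤ K := fun y s => by
    simp only [φ]
    split_ifs
    · exact hc _ _
    · simpa using (abs_nonneg _).trans (hc s.1 y)
  have hφη : ∀ y s, φ y s ≤ η := fun y s => by
    simp only [φ]
    split_ifs
    exacts [hcη _ _, hη]
  have hgb : ∀ x z, r x z = good x z + bad x z := fun x z => by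
    simp only [good, bad]; split_ifs <;> simp
  have hgood : ∀ x z, 0 ≤ good x z := fun x z => by
    simp only [good]; split_ifs; exacts [le_rfl, hr x z]
  have hbad : ∀ x z, 0 ≤ bad x z := fun x z => by
    simp only [bad]; split_ifs; exacts [hr x z, le_rfl]
  have hbadsum : ∑ x, ∑ z, bad x z ≤ κ := by
    have := (sum_ite_marginal_mul_log_le h h1 A B (zero_lt_one.trans hM)).trans hI
    rw [Fintype.sum_prod_type] at this
    exact le_of_mul_le_mul_right this (Real.log_pos hM)
  have step1 := sum_mul_le_sum_condIndep h h1 hν hν1 A B C hτ hK hJ φ hφK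
  have step2 : ∀ y, (∑ s : α × β × γ, marginal ρ (fun ω => (A ω, B ω)) (s.1, s.2.1) *
        marginal ρ (fun ω => (B ω, C y ω)) s.2 / marginal ρ B s.2.1 * φ y s) ≤
      (∑ x, ∑ z, ∑ v, good x z * R y z v * φ y (x, z, v)) + η * κ := by
    intro y
    calc _ = ∑ x, ∑ z, ∑ v, r x z * R y z v * φ y (x, z, v) := by
          simp only [Fintype.sum_prod_type, r, R, mul_div_assoc]
      _ = (∑ x, ∑ z, ∑ v, good x z * R y z v * φ y (x, z, v)) +
          ∑ x, ∑ z, ∑ v, bad x z * R y z v * φ y (x, z, v) := by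
          simp only [hgb, add_mul, sum_add_distrib]
      _ ≤ (∑ x, ∑ z, ∑ v, good x z * R y z v * φ y (x, z, v)) + ∑ x, ∑ z, bad x z * η := by
          refine add_le_add le_rfl (sum_le_sum fun x _ => sum_le_sum fun z _ => ?_)
          calc _ ≤ ∑ v, bad x z * R y z v * η := sum_le_sum fun v _ =>
                mul_le_mul_of_nonneg_left (hφη _ _) (mul_nonneg (hbad x z) (hR y z v))
            _ = bad x z * η * ∑ v, R y z v := by
                rw [mul_sum]; exact sum_congr rfl fun v _ => by ring
            _ ≤ bad x z * η * 1 :=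
                mul_le_mul_of_nonneg_left (hR1 y z) (mul_nonneg (hbad x z) hη)
            _ = _ := mul_one _
      _ ≤ _ := by
          simp only [← sum_mul]
          rw [mul_comm _ η]
          gcongr
  have step3 : δ < ∑ y, ν y * ∑ x, ∑ z, ∑ v, good x z * R y z v * φ y (x, z, v) := by
    have := sum_le_sum fun y (_ : y ∈ univ) => mul_le_mul_of_nonneg_left (step2 y) (hν y)
    simp only [mul_add, sum_add_distrib, ← sum_mul, hν1, one_mul] at this
    linarith
  -- Conditional independence allows v to be summed out separately from x, which leaves for each z a
  -- product weight in (x, y).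
  let w : β → υ → ℝ := fun z y => ν y * ∑ v, if t z y v then R y z v else 0
  have step4 : ∑ y, ν y * ∑ x, ∑ z, ∑ v, good x z * R y z v * φ y (x, z, v) =
      ∑ z, ∑ x, ∑ y, good x z * w z y * c x y := by
    have e : ∀ y x z, ∑ v, good x z * R y z v * φ y (x, z, v) =
        good x z * (∑ v, if t z y v then R y z v else 0) * c x y := by
      intro y x z
      rw [mul_sum, sum_mul]
      refine sum_congr rfl fun v _ => ?_
      by_cases ht : t z y v <;> simp [φ, ht]
    simp only [e, mul_sum (s := (univ : Finset α)), mul_sum (s := (univ : Finset β)), w]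
    rw [sum_comm]
    rw [sum_comm (s := (univ : Finset β))]
    refine sum_congr rfl fun x _ => ?_
    rw [sum_comm]
    exact sum_congr rfl fun z _ => sum_congr rfl fun y _ => by ring
  -- Averaging over z; the strict inequality rules out a z of probability zero.
  have step5 : ∃ z, δ * marginal ρ B z < ∑ x, ∑ y, good x z * w z y * c x y := by
    by_contra! hcon
    have := sum_le_sum fun z (_ : z ∈ univ) => hcon z
    rw [← step4, ← mul_sum, sum_marginal, h1] at this
    linarith
  obtain ⟨z, hz⟩ := step5
  have hz0 : 0 < marginal ρ B z := by
    refine (marginal_nonneg h B z).lt_of_ne fun h0 => ?_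
    have : ∀ x, good x z = 0 := fun x => by
      have hle : r x z ≤ 0 := h0 ▸ marginal_pair_le_right h A B x z
      simp only [good]
      split_ifs
      exacts [rfl, le_antisymm hle (hr x z)]
    simp [← h0, this] at hz
  have hgle : ∀ x, good x z / marginal ρ B z ≤ M * marginal ρ A x := fun x => by
    rw [div_le_iff₀ hz0]
    simp only [good]
    split_ifs with hlt
    · have := marginal_nonneg h A x
      positivity
    · rw [mul_assoc]; exact not_lt.1 hlt
  have hw : ∀ y, 0 ≤ w z y := fun y => mul_nonneg (hν y)
    (sum_nonneg fun v _ => by split_ifs; exacts [hR _ _ _, le_rfl])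
  have hwle : ∀ y, w z y ≤ ν y := fun y => by
    refine mul_le_of_le_one_right (hν y) ((sum_le_sum fun v _ => ?_).trans (hR1 y z))
    split_ifs
    exacts [le_rfl, hR _ _ _]
  obtain ⟨S, T, hST⟩ := exists_rectangle_le
    (fun x => div_nonneg (hgood x z) hz0.le) hgle hw hwle c
  refine ⟨S, T, ?_⟩
  have e1 : ∑ x, ∑ y, good x z / marginal ρ B z * w z y * c x y =
      (∑ x, ∑ y, good x z * w z y * c x y) / marginal ρ B z := by
    simp only [sum_div]
    exact sum_congr rfl fun x _ => sum_congr rfl fun y _ => by ring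
  rw [e1] at hST
  refine ((lt_div_iff₀ hz0).2 hz).le.trans (hST.trans_eq ?_)
  simp only [mul_sum]
  refine sum_congr rfl fun x _ => sum_congr rfl fun y _ => ?_
  split_ifs
  · ring
  · simp

/-! ### Product weights -/

theorem sum_prod_weight {ι : Type*} [Fintype ι] [DecidableEq ι] {a : ι → α → ℝ}
    (ha1 : ∀ i, ∑ x, a i x = 1) : ∑ ω : ι → α, ∏ i, a i (ω i) = 1 := by
  have := prod_univ_sum (fun _ : ι => (univ : Finset α)) a
  rw [Fintype.piFinset_univ] at this
  rw [← this]
  simp [ha1]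

theorem marginal_prod_weight {ι : Type*} [Fintype ι] [DecidableEq ι] {a : ι → α → ℝ}
    (ha1 : ∀ i, ∑ x, a i x = 1) (i : ι) (x : α) :
    marginal (fun ω : ι → α => ∏ j, a j (ω j)) (fun ω => ω i) x = a i x := by
  classical
  -- Fixing coordinate i at x keeps the weight a product, so its sum still factors.
  let b : ι → α → ℝ := fun j y => if j = i then (if y = x then a j y else 0) else a j y
  have e : ∀ ω : ι → α, (if ω i = x then ∏ j, a j (ω j) else 0) = ∏ j, b j (ω j) := by
    intro ω
    rw [← mul_prod_erase univ _ (mem_univ i), ← mul_prod_erase univ _ (mem_univ i)]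
    have : ∏ j ∈ univ.erase i, b j (ω j) = ∏ j ∈ univ.erase i, a j (ω j) :=
      prod_congr rfl fun j hj => by simp [b, ne_of_mem_erase hj]
    by_cases hx : ω i = x <;> simp [b, hx, this]
  have := prod_univ_sum (fun _ : ι => (univ : Finset α)) b
  rw [Fintype.piFinset_univ] at this
  calc _ = ∑ ω : ι → α, ∏ j, b j (ω j) := by simp only [marginal, ← e]
    _ = ∏ j, ∑ y, b j y := this.symm
    _ = a i x := by
      rw [← mul_prod_erase univ _ (mem_univ i)]
      have : ∏ j ∈ univ.erase i, ∑ y, b j y = 1 :=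
        prod_eq_one fun j hj => by simp [b, ne_of_mem_erase hj, ha1]
      rw [this]
      simp [b]

/-! ### Greedy observations and the choice of a query -/

section DataStructure

variable {Γ Λ : Type*} [Fintype Γ] [Nonempty Γ] [Fintype Λ] [Nonempty Λ]

/-- Observing `U` at finitely many points `ys`, chosen greedily, one reaches a state in which
one more observation at a random point gives little information on the average coordinate. -/
theorem exists_saturated_observations {k : ℕ} {a : α → ℝ} (ha : ∀ x, 0 ≤ a x)
    (ha1 : ∑ x, a x = 1) {ν : υ → ℝ} (hν : ∀ y, 0 ≤ ν y) (hν1 : ∑ y, ν y = 1)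
    {ρ : (Fin k → α) → ℝ} (hρ : ρ = fun ω => ∏ i, a (ω i))
    (P : Fin k → (Fin k → α) → Γ) (U : υ → (Fin k → α) → Λ) (m : ℕ) {g : ℝ}
    (hg : k * Real.log (Fintype.card Γ) + m * Real.log (Fintype.card Λ) < m * g) :
    ∃ (j : ℕ) (ys : Fin j → υ),
      ∑ i, mutualInfo ρ (fun ω => ω i) (fun ω => (P i ω, fun l => U (ys l) ω)) ≤
        k * Real.log (Fintype.card Γ) + m * Real.log (Fintype.card Λ) ∧
      ∑ y, ν y * ∑ i,
        (mutualInfo ρ (fun ω => ω i) (fun ω => ((P i ω, fun l => U (ys l) ω), U y ω)) -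
          mutualInfo ρ (fun ω => ω i) (fun ω => (P i ω, fun l => U (ys l) ω))) ≤ g := by
  have h : ∀ ω, 0 ≤ ρ ω := fun ω => by subst hρ; exact prod_nonneg fun i _ => ha _
  have h1 : ∑ ω, ρ ω = 1 := by subst hρ; exact sum_prod_weight (a := fun _ => a) fun _ => ha1
  have hm : ∀ i x, marginal ρ (fun ω => ω i) x = a x := by
    subst hρ; exact marginal_prod_weight (a := fun _ => a) fun _ => ha1
  let I : (j : ℕ) → (Fin j → υ) → ℝ := fun j ys =>
    ∑ i, mutualInfo ρ (fun ω => ω i) (fun ω => (P i ω, fun l => U (ys l) ω))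
  have hlog : 0 ≤ Real.log (Fintype.card Λ) :=
    Real.log_nonneg (by exact_mod_cast Fintype.card_pos)
  have hI : ∀ j ys, j ≤ m →
      I j ys ≤ k * Real.log (Fintype.card Γ) + m * Real.log (Fintype.card Λ) := by
    intro j ys hj
    calc I j ys ≤ ∑ i, (mutualInfo ρ (fun ω => ω i) (fun ω l => U (ys l) ω) +
          Real.log (Fintype.card Γ)) :=
          sum_le_sum fun i _ => mutualInfo_pair_le_add h h1 (fun ω => ω i)
            (fun ω l => U (ys l) ω) (P i)
      _ = ∑ i, mutualInfo ρ (fun ω => ω i) (fun ω l => U (ys l) ω) +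
          k * Real.log (Fintype.card Γ) := by simp [sum_add_distrib]
      _ ≤ Real.log (Fintype.card (Fin j → Λ)) + k * Real.log (Fintype.card Γ) := by
          gcongr
          exact sum_mutualInfo_eval_le (a := fun _ => a) (fun _ => ha)
            (fun ω => by rw [hρ]) h1 hm _
      _ = j * Real.log (Fintype.card Λ) + k * Real.log (Fintype.card Γ) := by
          simp [Real.log_pow]
      _ ≤ m * Real.log (Fintype.card Λ) + k * Real.log (Fintype.card Γ) := by gcongr
      _ = _ := add_comm _ _
  have hcons : ∀ j (ys : Fin j → υ) y, I (j + 1) (Fin.cons y ys) =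
      ∑ i, mutualInfo ρ (fun ω => ω i) (fun ω => ((P i ω, fun l => U (ys l) ω), U y ω)) := by
    intro j ys y
    refine sum_congr rfl fun i _ => mutualInfo_congr_right _ fun ω ω' => ?_
    simp only [Prod.mk.injEq, funext_iff, Fin.forall_fin_succ, Fin.cons_zero, Fin.cons_succ]
    tauto
  by_contra! hcon
  -- Without saturation each new observation can be chosen to gain more than g, but m·g exceeds the
  -- bound `hI`.
  have hgrow : ∀ j ≤ m, ∃ ys : Fin j → υ, j * g ≤ I j ys := by
    intro j
    induction j with
    | zero =>
      intro _
      refine ⟨Fin.elim0, ?_⟩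
      simp only [Nat.cast_zero, zero_mul]
      exact sum_nonneg fun i _ => mutualInfo_nonneg h h1 _ _
    | succ j ih =>
      intro hj
      obtain ⟨ys, hys⟩ := ih (by omega)
      have hgt := hcon j ys (hI j ys (by omega))
      have : ∃ y, g < I (j + 1) (Fin.cons y ys) - I j ys := by
        by_contra! hle
        refine absurd hgt (not_lt.2 ?_)
        calc _ = ∑ y, ν y * (I (j + 1) (Fin.cons y ys) - I j ys) := by
              simp only [hcons, I, sum_sub_distrib]
          _ ≤ ∑ y, ν y * g :=
              sum_le_sum fun y _ => mul_le_mul_of_nonneg_left (hle y) (hν y)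
          _ = g := by rw [← sum_mul, hν1, one_mul]
      obtain ⟨y, hy⟩ := this
      refine ⟨Fin.cons y ys, ?_⟩
      push_cast
      linarith
  obtain ⟨ys, hys⟩ := hgrow m le_rfl
  linarith [hI m ys le_rfl]

/-- Markov's inequality and a union bound: the three conditions fail for fractions at most 2/3, 1/7
and 1/7 of the indices, and 20/21 < 1. The error gets the smallest factor because it must stay below
the advantage of the predictor. -/
theorem exists_le_of_sum_le₃ {k : ℕ} (hk : 1 ≤ k) {e I J : Fin k → ℝ} (he : ∀ i, 0 ≤ e i)
    (hI : ∀ i, 0 ≤ I i) (hJ : ∀ i, 0 ≤ J i) {e₀ I₀ J₀ : ℝ} (he₀ : 0 < e₀) (hI₀ : 0 < I₀)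
    (hJ₀ : 0 < J₀) (hes : ∑ i, e i ≤ k * e₀) (hIs : ∑ i, I i ≤ k * I₀)
    (hJs : ∑ i, J i ≤ k * J₀) :
    ∃ i, e i ≤ 3 / 2 * e₀ ∧ I i ≤ 7 * I₀ ∧ J i ≤ 7 * J₀ := by
  by_contra! hcon
  have key : ∀ i, 1 ≤ e i / (3 / 2 * e₀) + I i / (7 * I₀) + J i / (7 * J₀) := by
    intro i
    have p1 : 0 ≤ e i / (3 / 2 * e₀) := div_nonneg (he i) (by positivity)
    have p2 : 0 ≤ I i / (7 * I₀) := div_nonneg (hI i) (by positivity)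
    have p3 : 0 ≤ J i / (7 * J₀) := div_nonneg (hJ i) (by positivity)
    by_cases c1 : e i ≤ 3 / 2 * e₀
    · by_cases c2 : I i ≤ 7 * I₀
      · have : 1 ≤ J i / (7 * J₀) := (one_le_div (by positivity)).2 (hcon i c1 c2).le
        linarith
      · have : 1 ≤ I i / (7 * I₀) := (one_le_div (by positivity)).2 (not_le.1 c2).le
        linarith
    · have : 1 ≤ e i / (3 / 2 * e₀) := (one_le_div (by positivity)).2 (not_le.1 c1).le
      linarith
  have hsum := sum_le_sum fun i (_ : i ∈ univ) => key i
  simp only [sum_add_distrib, ← sum_div, sum_const, card_univ, Fintype.card_fin, nsmul_eq_mul,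
    mul_one] at hsum
  have hk' : (1 : ℝ) ≤ k := by exact_mod_cast hk
  have b1 : (∑ i, e i) / (3 / 2 * e₀) ≤ k * (2 / 3) := by
    rw [div_le_iff₀ (by positivity)]; linarith
  have b2 : (∑ i, I i) / (7 * I₀) ≤ k * (1 / 7) := by
    rw [div_le_iff₀ (by positivity)]; linarith
  have b3 : (∑ i, J i) / (7 * J₀) ≤ k * (1 / 7) := by
    rw [div_le_iff₀ (by positivity)]; linarith
  linarith

open Classical in
/-- A deterministic data structure, in which the answer to query `i` depends on a short function
`P i` of the data and on `y`, `U y`, yields large almost monochromatic rectangles. -/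
theorem exists_monochromatic_of_answers {k : ℕ} (hk : 1 ≤ k) {a : α → ℝ} (ha : ∀ x, 0 ≤ a x)
    (ha1 : ∑ x, a x = 1) {ν : υ → ℝ} (hν : ∀ y, 0 ≤ ν y) (hν1 : ∑ y, ν y = 1)
    {ρ : (Fin k → α) → ℝ} (hρ : ρ = fun ω => ∏ i, a (ω i))
    (P : Fin k → (Fin k → α) → Γ) (U : υ → (Fin k → α) → Λ) (t : Fin k → Γ → υ → Λ → Bool)
    (g : α → υ → Option Bool) {ε bal Q L : ℝ} (hε : 0 < ε) (hε1 : ε ≤ 1) (hbal : 2 * ε ≤ bal)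
    (hQ : 1 ≤ Q) (hP : Real.log (Fintype.card Γ) ≤ Q * Real.log 2)
    (hU : Real.log (Fintype.card Λ) ≤ L * Real.log 2) (hL : L < ε ^ 2 / 12960 * k)
    (herr : ∑ i, ∑ y, ν y * ∑ ω, ρ ω *
      (if g (ω i) y = some (!(t i (P i ω) y (U y ω))) then 1 else 0) ≤ k * ε)
    (b : Bool) (hb : bal ≤ ∑ y, ν y * ∑ x, a x * if g x y = some b then 1 else 0) :
    ∃ (S : Set α) (T : Set υ), ε / 2 ≤ Real.exp (256 * Q / bal) *
      ∑ x, ∑ y, if x ∈ S ∧ y ∈ T then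
        a x * ν y * (16 * (ε / bal) - if g x y = some (!b) then 1 else 0) else 0 := by
  have h : ∀ ω, 0 ≤ ρ ω := fun ω => by subst hρ; exact prod_nonneg fun i _ => ha _
  have h1 : ∑ ω, ρ ω = 1 := by subst hρ; exact sum_prod_weight (a := fun _ => a) fun _ => ha1
  have hm : ∀ i x, marginal ρ (fun ω => ω i) x = a x := by
    subst hρ; exact marginal_prod_weight (a := fun _ => a) fun _ => ha1
  have hbal0 : 0 < bal := by linarith
  have hk' : (1 : ℝ) ≤ k := by exact_mod_cast hk
  have l2 := Real.log_two_gt_d9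
  have l2' := Real.log_two_lt_d9
  -- 12960 = 40·18², so that 4·`J i` ≤ 40·c₁ = (ε/18)² for the selected i.
  set c₁ : ℝ := ε ^ 2 / 12960 with hc₁
  have hc₁0 : 0 < c₁ := by positivity
  have hc₁1 : c₁ ≤ 1 := by rw [hc₁]; nlinarith
  -- From Q ≤ m·c₁ ≤ 2Q, the total kQ + mL is below m·(2c₁k), which gives the gain threshold, and at
  -- most 3kQ, which bounds the information in B.
  set m : ℕ := ⌈Q / c₁⌉₊ with hmdef
  have hm1 : Q ≤ m * c₁ := (div_le_iff₀ hc₁0).1 (Nat.le_ceil _)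
  have hm2 : m * c₁ ≤ Q + c₁ := by
    have := (Nat.ceil_lt_add_one (by positivity : 0 ≤ Q / c₁)).le
    calc (m : ℝ) * c₁ ≤ (Q / c₁ + 1) * c₁ := by gcongr
      _ = Q + c₁ := by field_simp
  have hm0 : (0 : ℝ) < m := by
    by_contra hcon
    nlinarith
  have hPU : k * Real.log (Fintype.card Γ) + m * Real.log (Fintype.card Λ) ≤
      (k * Q + m * L) * Real.log 2 := by
    have e1 := mul_le_mul_of_nonneg_left hP (by linarith : (0 : ℝ) ≤ k)
    have e2 := mul_le_mul_of_nonneg_left hU hm0.le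
    linarith
  have hmL : m * L < m * (c₁ * k) := mul_lt_mul_of_pos_left hL hm0
  have hkQ : k * Q ≤ k * (m * c₁) := mul_le_mul_of_nonneg_left hm1 (by linarith)
  have hkQ' : k * (m * c₁) ≤ k * (2 * Q) := mul_le_mul_of_nonneg_left (by linarith) (by linarith)
  obtain ⟨j, ys, hIs, hJs⟩ := exists_saturated_observations ha ha1 hν hν1 hρ P U m
    (g := 2 * c₁ * k * Real.log 2) (hPU.trans_lt (by
      have : k * Q + m * L < m * (2 * c₁ * k) := by linarith
      have := mul_lt_mul_of_pos_right this (by linarith : 0 < Real.log 2)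
      linarith))
  set I : Fin k → ℝ := fun i =>
    mutualInfo ρ (fun ω => ω i) (fun ω => (P i ω, fun l => U (ys l) ω)) with hIdef
  set J : Fin k → ℝ := fun i => ∑ y, ν y *
    (mutualInfo ρ (fun ω => ω i) (fun ω => ((P i ω, fun l => U (ys l) ω), U y ω)) - I i) with hJdef
  set e : Fin k → ℝ := fun i => ∑ y, ν y * ∑ ω, ρ ω *
      (if g (ω i) y = some (!(t i (P i ω) y (U y ω))) then 1 else 0) with hedef
  obtain ⟨i, hei, hIi, hJi⟩ := exists_le_of_sum_le₃ hk (e := e) (I := I) (J := J)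
    (fun i => sum_nonneg fun y _ => mul_nonneg (hν y) (sum_nonneg fun ω _ => mul_nonneg (h ω)
      (by split_ifs <;> norm_num)))
    (fun i => mutualInfo_nonneg h h1 _ _)
    (fun i => sum_nonneg fun y _ => mul_nonneg (hν y) (by
      have := (sq_nonneg _).trans (sq_sum_abs_marginal_sub_le h h1 (fun ω => ω i)
        (fun ω => (P i ω, fun l => U (ys l) ω)) (U y))
      linarith))
    (e₀ := ε) (I₀ := 3 * Q * Real.log 2) (J₀ := 2 * c₁ * Real.log 2)
    hε (by positivity) (by positivity) herr
    (hIs.trans (hPU.trans (by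
      have : k * Q + m * L ≤ k * (3 * Q) := by linarith
      have := mul_le_mul_of_nonneg_right this (by linarith : 0 ≤ Real.log 2)
      linarith)))
    (by
      refine le_trans (le_of_eq ?_) (hJs.trans_eq (by ring))
      simp only [hJdef, hIdef]
      rw [sum_comm]
      exact sum_congr rfl fun y _ => (mul_sum _ _ _).symm)
  set η : ℝ := 16 * (ε / bal) with hη
  have hη0 : 0 ≤ η := by positivity
  have hη8 : η ≤ 8 := by
    have : ε / bal ≤ 1 / 2 := by rw [div_le_iff₀ hbal0]; linarith
    linarith
  have hηbal : η * bal = 16 * ε := by rw [hη]; field_simp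
  -- The losses δ + Kτ + ηκ = ε/2 + ε/2 + ε = 2ε stay below the advantage, which is at least 16ε −
  -- 9·(3/2)ε = 5ε/2. The choice of M makes κ·log M = 16Q, enough for `I i` + 1.
  obtain ⟨S, T, hST⟩ := exists_rectangle_of_predictor h h1 hν hν1 (fun ω => ω i)
    (fun ω => (P i ω, fun l => U (ys l) ω)) U (τ := ε / 18) (K := 9) (η := η)
    (M := Real.exp (256 * Q / bal)) (κ := bal / 16) (δ := ε / 2) (by positivity) (by norm_num)
    (by rw [Real.one_lt_exp_iff]; positivity)
    (by
      have : 4 * J i ≤ 40 * c₁ := by nlinarith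
      refine this.trans (le_of_eq ?_)
      rw [hc₁]; ring)
    (by
      rw [Real.log_exp]
      have e1 : bal / 16 * (256 * Q / bal) = 16 * Q := by field_simp; norm_num
      rw [e1]
      have : I i ≤ 15 * Q := by nlinarith
      change I i + 1 ≤ _
      linarith)
    (fun z y v => t i z.1 y v = b) (fun x y => η - if g x y = some (!b) then 1 else 0)
    (fun x y => by split_ifs <;> rw [abs_le] <;> constructor <;> linarith)
    (fun x y => by split_ifs <;> linarith) hη0
    (by
      -- An error on g = b forfeits η, and an error on g = 1−b yields η − 1; the charge η + 1 covers
      -- both. Points where g is undefined contribute at least 0.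
      have hpt : ∀ y ω, η * (if g (ω i) y = some b then 1 else 0) -
          (η + 1) * (if g (ω i) y = some (!(t i (P i ω) y (U y ω))) then 1 else 0) ≤
          if t i (P i ω) y (U y ω) = b then (η - if g (ω i) y = some (!b) then 1 else 0)
            else 0 := by
        intro y ω
        generalize t i (P i ω) y (U y ω) = s
        rcases g (ω i) y with _ | v
        · simp; split_ifs <;> linarith
        · cases b <;> cases s <;> cases v <;> simp <;> linarith
      have hcor : η * bal - (η + 1) * e i ≤ ∑ y, ν y * ∑ ω, ρ ω *
          if t i (P i ω) y (U y ω) = b then (η - if g (ω i) y = some (!b) then 1 else 0)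
            else 0 := by
        have hb' : bal ≤ ∑ y, ν y * ∑ ω, ρ ω * if g (ω i) y = some b then 1 else 0 := by
          refine hb.trans_eq (sum_congr rfl fun y _ => ?_)
          rw [← sum_marginal_mul ρ (fun ω => ω i) fun x => if g x y = some b then (1 : ℝ) else 0]
          simp only [hm]
        calc η * bal - (η + 1) * e i ≤
            η * (∑ y, ν y * ∑ ω, ρ ω * if g (ω i) y = some b then 1 else 0) -
              (η + 1) * e i := by gcongr
          _ = ∑ y, ν y * ∑ ω, ρ ω * (η * (if g (ω i) y = some b then 1 else 0) -
          (η + 1) * (if g (ω i) y = some (!(t i (P i ω) y (U y ω))) then 1 else 0)) := by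
            simp only [hedef, mul_sum, ← sum_sub_distrib]
            exact sum_congr rfl fun y _ => sum_congr rfl fun ω _ => by ring
          _ ≤ _ := sum_le_sum fun y _ => mul_le_mul_of_nonneg_left (sum_le_sum fun ω _ =>
            mul_le_mul_of_nonneg_left (hpt y ω) (h ω)) (hν y)
      refine lt_of_lt_of_le ?_ (hcor.trans_eq (by congr!))
      have he2 : (η + 1) * e i ≤ (η + 1) * (3 / 2 * ε) :=
        mul_le_mul_of_nonneg_left hei (by linarith)
      have he3 : η * ε ≤ 8 * ε := mul_le_mul_of_nonneg_right hη8 hε.le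
      linarith)
  simp only [hm] at hST
  exact ⟨S, T, hST⟩

end DataStructure

end FiniteInfo

end

noncomputable section

namespace Multiphase

open Finset FiniteInfo

/-! ### Transcripts of decision trees -/

namespace DecisionTree

variable {A A₁ A₂ V O : Type}

theorem depth_next_le [Fintype V] {a : A} {next : V → DecisionTree A V O} {d : ℕ}
    (h : (probe a next).depth ≤ d + 1) (v : V) : (next v).depth ≤ d := by
  rw [depth] at h
  have := le_sup (f := fun v => depth (next v)) (mem_univ v)
  omega

/-- The contents read along the path determine the output. Short paths are padded with an arbitrary
value, so all transcripts have length d. -/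
theorem exists_transcript [Fintype V] [Nonempty V] (T : DecisionTree A V O) {d : ℕ} (hd : T.depth ≤ d) :
    ∃ (φ : (A → V) → Fin d → V) (ψ : (Fin d → V) → O), ∀ mem, T.eval mem = ψ (φ mem) := by
  induction T generalizing d with
  | output o => exact ⟨fun _ _ => Classical.arbitrary V, fun _ => o, fun _ => rfl⟩
  | probe a next ih =>
    obtain _ | d := d
    · rw [depth] at hd; omega
    choose φ ψ h using fun v => ih v (depth_next_le hd v)
    refine ⟨fun mem => Fin.cons (mem a) (φ (mem a) mem), fun s => ψ (s 0) (Fin.tail s),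
      fun mem => ?_⟩
    simp [eval, h]

theorem OnlySecond.eval_eq {T : DecisionTree (A₁ ⊕ A₂) V O} (h : T.OnlySecond) (m₁ m₁' : A₁ → V)
    (m₂ : A₂ → V) : T.eval (Sum.elim m₁ m₂) = T.eval (Sum.elim m₁' m₂) := by
  induction T with
  | output o => rfl
  | probe a next ih =>
    cases a with
    | inl a => exact h.elim
    | inr a => exact ih _ (h _)

/-- As the first memory is probed first, its transcript `φ` cannot depend on the second memory,
hence not on y. Probes to the second memory are not recorded: `ψ` sees all of it. -/
theorem FirstThenSecond.exists_transcript [Fintype V] [Nonempty V] {T : DecisionTree (A₁ ⊕ A₂) V O}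
    (h : T.FirstThenSecond) {d : ℕ} (hd : T.depth ≤ d) :
    ∃ (φ : (A₁ → V) → Fin d → V) (ψ : (Fin d → V) → (A₂ → V) → O),
      ∀ m₁ m₂, T.eval (Sum.elim m₁ m₂) = ψ (φ m₁) m₂ := by
  induction T generalizing d with
  | output o => exact ⟨fun _ _ => Classical.arbitrary V, fun _ _ => o, fun _ _ => rfl⟩
  | probe a next ih =>
    obtain _ | d := d
    · rw [depth] at hd; omega
    cases a with
    | inl a =>
      choose φ ψ h using fun v => ih v (h v) (depth_next_le hd v)
      refine ⟨fun m₁ => Fin.cons (m₁ a) (φ (m₁ a) m₁), fun s => ψ (s 0) (Fin.tail s),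
        fun m₁ m₂ => ?_⟩
      simp [eval, h]
    | inr a =>
      refine ⟨fun _ _ => Classical.arbitrary V,
        fun _ m₂ => (next (m₂ a)).eval (Sum.elim (fun _ => Classical.arbitrary V) m₂),
        fun m₁ m₂ => ?_⟩
      exact OnlySecond.eval_eq (h (m₂ a)) _ _ _

end DecisionTree

/-! ### Probabilities as finite sums -/

theorem sum_toReal {X : Type} [Fintype X] (μ : PMF X) : ∑ x, (μ x).toReal = 1 := by
  rw [← ENNReal.toReal_sum fun x _ => μ.apply_ne_top x, ← tsum_fintype (L := .unconditional _),
    μ.tsum_coe, ENNReal.toReal_one]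

open Classical in
theorem prob_eq_sum {X : Type} [Fintype X] (μ : PMF X) (S : Set X) :
    prob μ S = ∑ x, (μ x).toReal * if x ∈ S then 1 else 0 := by
  rw [prob, PMF.toOuterMeasure_apply, tsum_fintype, ENNReal.toReal_sum]
  · refine sum_congr rfl fun x _ => ?_
    by_cases h : x ∈ S <;> simp [h]
  · intro x _
    by_cases h : x ∈ S <;> simp [h, μ.apply_ne_top]

theorem prob_nonneg {X : Type} (μ : PMF X) (S : Set X) : 0 ≤ prob μ S :=
  ENNReal.toReal_nonneg

theorem prob_le_one {X : Type} [Fintype X] (μ : PMF X) (S : Set X) : prob μ S ≤ 1 := by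
  classical
  rw [prob_eq_sum]
  refine le_of_le_of_eq (sum_le_sum fun x _ => ?_) (sum_toReal μ)
  split_ifs <;> simp

theorem prob_prod_eq_sum {X Y : Type} [Fintype X] [Fintype Y] {μ : PMF (X × Y)} {μ₁ : PMF X}
    {μ₂ : PMF Y} (h : ∀ x y, μ (x, y) = μ₁ x * μ₂ y) (p : X → Y → Prop)
    [∀ x y, Decidable (p x y)] :
    prob μ {q | p q.1 q.2} =
      ∑ y, (μ₂ y).toReal * ∑ x, (μ₁ x).toReal * if p x y then 1 else 0 := by
  classical
  rw [prob_eq_sum, Fintype.sum_prod_type_right]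
  refine sum_congr rfl fun y _ => ?_
  rw [mul_sum]
  refine sum_congr rfl fun x _ => ?_
  rw [h, ENNReal.toReal_mul]
  by_cases hp : p x y <;> simp [hp, mul_comm]

-- Some point does no worse than the expectation. It must lie in the support, where the depth bounds
-- and the probe order are guaranteed; an integral is used because there are infinitely many trees.
open Classical MeasureTheory in
theorem exists_mem_support_sum_le {Ω ι : Type} [Fintype ι] (μ : PMF Ω) (E : ι → Set Ω)
    (c : ι → ℝ) :
    ∃ T ∈ μ.support, ∑ i, c i * (if T ∈ E i then 1 else 0) ≤ ∑ i, c i * prob μ (E i) := by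
  let _ : MeasurableSpace Ω := ⊤
  have hE : ∀ i, MeasurableSet (E i) := fun _ => trivial
  have hint : ∀ i, Integrable ((E i).indicator fun _ => (1 : ℝ)) μ.toMeasure := fun i =>
    (integrable_const 1).indicator (hE i)
  have hnull : μ.toMeasure μ.supportᶜ = 0 := by
    rw [PMF.toMeasure_apply_eq_zero_iff μ trivial]
    exact disjoint_compl_right
  obtain ⟨T, hT, hle⟩ := exists_notMem_null_le_integral
    (f := fun T => ∑ i, c i * (E i).indicator (fun _ => (1 : ℝ)) T)
    (integrable_finsetSum _ fun i _ => (hint i).const_mul (c i)) hnull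
  refine ⟨T, by simpa using hT, ?_⟩
  rw [integral_finsetSum _ fun i _ => (hint i).const_mul (c i)] at hle
  convert hle using 2 with i _ i _
  · simp [Set.indicator_apply]
  · rw [integral_const_mul, integral_indicator_const _ (hE i), prob, Measure.real,
      PMF.toMeasure_apply_eq_toOuterMeasure_apply _ (hE i)]
    simp

theorem prob_compl {Ω : Type} (μ : PMF Ω) (S : Set Ω) : prob μ Sᶜ = 1 - prob μ S := by
  let _ : MeasurableSpace Ω := ⊤
  rw [prob, prob, ← PMF.toMeasure_apply_eq_toOuterMeasure_apply μ (trivial : MeasurableSet S),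
    ← PMF.toMeasure_apply_eq_toOuterMeasure_apply μ (trivial : MeasurableSet Sᶜ)]
  exact MeasureTheory.probReal_compl_eq_one_sub trivial

/-! ### Fixing the trees of a randomized scheme -/

section Scheme

variable {n k w s u : ℕ} {f : Bits n → Bits n → Option Bool} {tu tq err : ℝ}

/-- Where f is undefined the event is empty, and `herr` suffices. -/
theorem RandomizedScheme.prob_error_le (D : RandomizedScheme f k w s u tu tq err) (herr : 0 ≤ err)
    (x : Fin k → Bits n) (y : Bits n) (i : Fin k) :
    prob D.law {T | f (x i) y = some (!(T.answer (D.encode x) y i))} ≤ err := by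
  cases hf : f (x i) y with
  | none => simpa [prob] using herr
  | some b =>
    have := D.correct x y i b hf
    have e : {T : Trees n k w s u | some b = some (!(T.answer (D.encode x) y i))} =
        {T | T.answer (D.encode x) y i = b}ᶜ := by
      ext T
      simp only [Set.mem_ofPred_eq, Set.mem_compl_iff]
      cases b <;> cases T.answer (D.encode x) y i <;> simp
    rw [e, prob_compl]
    linarith

theorem RandomizedScheme.exists_trees (D : RandomizedScheme f k w s u tu tq err) (herr : 0 ≤ err)
    {ν : Bits n → ℝ} (hν : ∀ y, 0 ≤ ν y) (hν1 : ∑ y, ν y = 1)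
    {ρ : (Fin k → Bits n) → ℝ} (hρ : ∀ ω, 0 ≤ ρ ω) (hρ1 : ∑ ω, ρ ω = 1) :
    ∃ T ∈ D.law.support, ∑ i, ∑ y, ν y * ∑ ω, ρ ω *
      (if f (ω i) y = some (!(T.answer (D.encode ω) y i)) then 1 else 0) ≤ k * err := by
  classical
  obtain ⟨T, hT, hle⟩ := exists_mem_support_sum_le D.law
    (fun j : Fin k × Bits n × (Fin k → Bits n) =>
      {T | f (j.2.2 j.1) j.2.1 = some (!(T.answer (D.encode j.2.2) j.2.1 j.1))})
    (fun j => ν j.2.1 * ρ j.2.2)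
  refine ⟨T, hT, ?_⟩
  have h2 := hle.trans (sum_le_sum fun j _ => mul_le_mul_of_nonneg_left
    (D.prob_error_le herr j.2.2 j.2.1 j.1) (mul_nonneg (hν _) (hρ _)))
  simp only [Fintype.sum_prod_type, Set.mem_ofPred_eq, ← sum_mul, ← mul_sum, hρ1, hν1, mul_one,
    sum_const, card_univ, Fintype.card_fin, nsmul_eq_mul] at h2
  simp only [mul_sum, ← mul_assoc]
  refine le_of_eq_of_le ?_ h2
  congr!

end Scheme

theorem log_card_transcripts (d w : ℕ) :
    Real.log (Fintype.card (Fin d → Bits w)) = (d * w : ℝ) * Real.log 2 := by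
  simp [Bits, Real.log_pow, mul_assoc]

/-! ### Bounding the corruption bound -/

theorem le_maxMono {X Y : Type} [Fintype X] [Fintype Y] {μ : PMF (X × Y)} {ρ : ℝ}
    {f : X → Y → Option Bool} {b : Bool} {A : Set X} {B : Set Y}
    (h : IsErrorMonochromatic μ ρ f b A B) : prob μ (A ×ˢ B) ≤ maxMono μ ρ f b := by
  refine le_csSup ⟨1, ?_⟩ ⟨A, B, h, rfl⟩
  rintro _ ⟨A, B, _, rfl⟩
  exact prob_le_one _ _

theorem corruptionBound_le {X Y : Type} {μ : PMF (X × Y)} {ρ m : ℝ} {f : X → Y → Option Bool}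
    (hm : 0 < m) (h : ∀ b, m ≤ maxMono μ ρ f b) :
    corruptionBound μ ρ f ≤ Real.logb 2 (1 / m) := by
  have h1 : m ≤ mono μ ρ f := le_min (h _) (h _)
  exact Real.logb_le_logb_of_le one_lt_two (by have := hm.trans_le h1; positivity)
    (one_div_le_one_div_of_le hm h1)

/-- The main term is 256Q/log 2 < 370Q; the terms from 32 and from 1/bal are bounded after
multiplication by bal, and Q ≥ 1 absorbs them. -/
theorem mul_logb_le {bal Q : ℝ} (hbal : 0 < bal) (hbal1 : bal ≤ 1) (hQ : 1 ≤ Q) :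
    bal * Real.logb 2 (1 / (bal / (32 * Real.exp (256 * Q / bal)))) ≤ 400 * Q := by
  have l2 := Real.log_two_gt_d9
  have l2' := Real.log_two_lt_d9
  have e : Real.log (1 / (bal / (32 * Real.exp (256 * Q / bal)))) =
      5 * Real.log 2 + 256 * Q / bal - Real.log bal := by
    rw [one_div_div, Real.log_div (by positivity) hbal.ne', Real.log_mul (by norm_num)
      (by positivity), Real.log_exp, show (32 : ℝ) = 2 ^ 5 by norm_num, Real.log_pow]
    norm_num
  have hl : -(bal * Real.log bal) ≤ 1 := by
    have := Real.one_sub_inv_le_log_of_pos hbal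
    have := mul_le_mul_of_nonneg_left this hbal.le
    rw [mul_sub, mul_inv_cancel₀ hbal.ne'] at this
    linarith
  rw [Real.logb, e, mul_div_assoc', div_le_iff₀ (by linarith)]
  have : bal * (5 * Real.log 2 + 256 * Q / bal - Real.log bal) =
      bal * (5 * Real.log 2) + 256 * Q - bal * Real.log bal := by
    field_simp
  rw [this]
  nlinarith

-- For R = S × T and η = 16ε/bal the double sum is η·μ(R) − μ(R ∩ g⁻¹(1−b)). Its positivity makes R
-- monochromatic, and dropping the negative term leaves μ(R) ≥ ε/(2Mη) = bal/(32M).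
open Classical in
theorem le_maxMono_of_sum {X Y : Type} [Fintype X] [Fintype Y] {μ : PMF (X × Y)} {μ₁ : PMF X}
    {μ₂ : PMF Y} (hμ : ∀ x y, μ (x, y) = μ₁ x * μ₂ y) {ε bal M : ℝ} (hε : 0 < ε) (hbal : 0 < bal)
    (hM : 0 < M) {g : X → Y → Option Bool} {b : Bool} {S : Set X} {T : Set Y}
    (h : ε / 2 ≤ M * ∑ x, ∑ y, if x ∈ S ∧ y ∈ T then (μ₁ x).toReal * (μ₂ y).toReal *
      (16 * (ε / bal) - if g x y = some (!b) then 1 else 0) else 0) :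
    bal / (32 * M) ≤ maxMono μ (16 * (ε / bal)) g b := by
  have e : ∑ x, ∑ y, (if x ∈ S ∧ y ∈ T then (μ₁ x).toReal * (μ₂ y).toReal *
      (16 * (ε / bal) - if g x y = some (!b) then 1 else 0) else 0) =
      16 * (ε / bal) * prob μ (S ×ˢ T) - prob μ ((S ×ˢ T) ∩ fiber g (!b)) := by
    rw [prob_eq_sum, prob_eq_sum, mul_sum, ← sum_sub_distrib, Fintype.sum_prod_type]
    refine sum_congr rfl fun x _ => sum_congr rfl fun y _ => ?_
    rw [hμ, ENNReal.toReal_mul]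
    by_cases h1 : x ∈ S ∧ y ∈ T
    · by_cases h2 : g x y = some (!b) <;> simp [h1, h2, fiber] <;> ring
    · have h3 : (x, y) ∉ S ×ˢ T := by simpa using h1
      have h4 : (x, y) ∉ (S ×ˢ T) ∩ fiber g (!b) := fun h => h3 h.1
      rw [if_neg h1, if_neg h3, if_neg h4]
      simp
  rw [e] at h
  have hpos := pos_of_mul_pos_right (lt_of_lt_of_le (by positivity : 0 < ε / 2) h) hM.le
  refine le_trans ?_ (le_maxMono (A := S) (B := T) (by
    rw [IsErrorMonochromatic]; linarith))
  have h5 : ε / 2 ≤ M * (16 * (ε / bal) * prob μ (S ×ˢ T)) :=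
    h.trans (mul_le_mul_of_nonneg_left (by linarith [prob_nonneg μ ((S ×ˢ T) ∩ fiber g (!b))])
      hM.le)
  rw [div_le_iff₀ (by positivity)]
  have h6 := mul_le_mul_of_nonneg_left h5 (by positivity : 0 ≤ 2 * bal / ε)
  have e1 : 2 * bal / ε * (ε / 2) = bal := by field_simp
  have e2 : 2 * bal / ε * (M * (16 * (ε / bal) * prob μ (S ×ˢ T))) =
      prob μ (S ×ˢ T) * (32 * M) := by field_simp; ring
  rwa [e1, e2] at h6

/-! ### From schemes to the smooth corruption bound -/

theorem RandomizedScheme.mul_corruptionBound_le {n k w s u : ℕ} {tu tq lam εt ε bal : ℝ}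
    {f g : Bits n → Bits n → Option Bool} {μ : PMF (Bits n × Bits n)} (hk : 1 ≤ k) (hw : 1 ≤ w)
    (hεt : 0 ≤ εt) (hε : 0 < ε) (hεlam : ε = εt + lam) (hεbal : 2 * ε ≤ bal)
    (hμ : IsProductDist μ) (hf : IsBalanced μ f (bal + lam)) (hfg : IsClose μ lam f g)
    (D : RandomizedScheme f k w s u tu tq εt) (hD : D.SemiAdaptive)
    (htu : tu * n < ε ^ 2 / 12960 * ((k : ℝ) / w)) :
    bal * corruptionBound μ (16 * (ε / bal)) g ≤ 400 * (tq * w) := by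
  classical
  obtain ⟨μ₁, μ₂, hμ⟩ := hμ
  set a : Bits n → ℝ := fun x => (μ₁ x).toReal with ha_def
  set ν : Bits n → ℝ := fun y => (μ₂ y).toReal with hν_def
  have ha : ∀ x, 0 ≤ a x := fun x => ENNReal.toReal_nonneg
  have hν : ∀ y, 0 ≤ ν y := fun y => ENNReal.toReal_nonneg
  have ha1 : ∑ x, a x = 1 := sum_toReal μ₁
  have hν1 : ∑ y, ν y = 1 := sum_toReal μ₂
  set ρ : (Fin k → Bits n) → ℝ := fun ω => ∏ i, a (ω i) with hρ_def
  have hρ : ∀ ω, 0 ≤ ρ ω := fun ω => prod_nonneg fun i _ => ha _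
  have hρ1 : ∑ ω, ρ ω = 1 := sum_prod_weight (a := fun _ => a) fun _ => ha1
  have hm : ∀ i x, marginal ρ (fun ω => ω i) x = a x :=
    marginal_prod_weight (a := fun _ => a) fun _ => ha1
  have hk' : (1 : ℝ) ≤ k := by exact_mod_cast hk
  have hw' : (1 : ℝ) ≤ w := by exact_mod_cast hw
  have hbal0 : 0 < bal := by linarith
  have hcoord : ∀ (i : Fin k) (φ : Bits n → Bits n → ℝ),
      ∑ y, ν y * ∑ ω, ρ ω * φ (ω i) y = ∑ y, ν y * ∑ x, a x * φ x y := by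
    intro i φ
    refine sum_congr rfl fun y _ => ?_
    rw [← sum_marginal_mul ρ (fun ω => ω i) fun x => φ x y]
    simp only [hm]
  have hclose : ∑ y, ν y * ∑ x, a x * (if f x y ≠ g x y then 1 else 0) ≤ lam :=
    le_of_eq_of_le (prob_prod_eq_sum hμ fun x y => f x y ≠ g x y).symm hfg
  -- Replacing f by g costs `lam` of the balance here, and `lam` of the error in `herr'`.
  have hbal : ∀ b, bal ≤ ∑ y, ν y * ∑ x, a x * if g x y = some b then 1 else 0 := by
    intro b
    have h1 : bal + lam ≤ ∑ y, ν y * ∑ x, a x * if f x y = some b then 1 else 0 :=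
      (hf b).trans_eq (prob_prod_eq_sum hμ fun x y => f x y = some b)
    have h2 : ∑ y, ν y * ∑ x, a x * (if f x y = some b then 1 else 0) ≤
        ∑ y, ν y * ∑ x, a x * ((if g x y = some b then 1 else 0) +
          if f x y ≠ g x y then 1 else 0) := by
      refine sum_le_sum fun y _ => mul_le_mul_of_nonneg_left (sum_le_sum fun x _ =>
        mul_le_mul_of_nonneg_left ?_ (ha x)) (hν y)
      by_cases h : f x y = g x y
      · simp [h]
      · simp only [h, ne_eq, not_false_eq_true, if_true]
        split_ifs <;> norm_num
    simp only [mul_add, sum_add_distrib] at h2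
    linarith
  have hbal1 : bal ≤ 1 := (hbal true).trans <| by
    calc _ ≤ ∑ y, ν y * ∑ x, a x := by
          refine sum_le_sum fun y _ => mul_le_mul_of_nonneg_left (sum_le_sum fun x _ => ?_) (hν y)
          exact mul_le_of_le_one_right (ha x) (by split_ifs <;> norm_num)
      _ = 1 := by simp [ha1, hν1]
  obtain ⟨T, hT, herr⟩ := D.exists_trees hεt hν hν1 hρ hρ1
  have herr' : ∑ i, ∑ y, ν y * ∑ ω, ρ ω *
      (if g (ω i) y = some (!(T.answer (D.encode ω) y i)) then 1 else 0) ≤ k * ε := by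
    calc _ ≤ ∑ i, ∑ y, ν y * ∑ ω, ρ ω *
          ((if f (ω i) y = some (!(T.answer (D.encode ω) y i)) then 1 else 0) +
            if f (ω i) y ≠ g (ω i) y then 1 else 0) := by
          refine sum_le_sum fun i _ => sum_le_sum fun y _ => mul_le_mul_of_nonneg_left
            (sum_le_sum fun ω _ => mul_le_mul_of_nonneg_left ?_ (hρ ω)) (hν y)
          by_cases h : f (ω i) y = g (ω i) y
          · simp [h]
          · simp only [h, ne_eq, not_false_eq_true, if_true]
            split_ifs <;> norm_num
      _ ≤ k * εt + ∑ _i : Fin k, lam := by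
          simp only [mul_add, sum_add_distrib]
          refine add_le_add herr (sum_le_sum fun i _ => ?_)
          rw [hcoord i fun x y => if f x y ≠ g x y then 1 else 0]
          exact hclose
      _ = k * ε := by simp [hεlam, mul_add]
  set d := ⌊tq⌋₊ with hd
  have hqd : ∀ i, (T.query i).depth ≤ d := fun i => Nat.le_floor (D.query_depth T hT i)
  have hud : ∀ y, (T.update y).depth ≤ ⌊n * tu⌋₊ := fun y =>
    Nat.le_floor (D.update_depth T hT y)
  have htq : 0 ≤ tq := (Nat.cast_nonneg _).trans (D.query_depth T hT ⟨0, hk⟩)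
  have htu0 : 0 ≤ n * tu := (Nat.cast_nonneg _).trans (D.update_depth T hT fun _ => false)
  choose P R hPR using fun i => (hD T hT i).exists_transcript (hqd i)
  choose C W hCW using fun y => (T.update y).exists_transcript (hud y)
  have hans : ∀ ω y i, T.answer (D.encode ω) y i =
      R i (P i (D.encode ω)) (W y (C y (D.encode ω))) := fun ω y i => by
    rw [Trees.answer, hPR, hCW]
  -- A query without probes has a constant answer and errs on g with probability at least bal ≥ 2ε.
  -- Excluding this gives Q = d·w ≥ 1.
  have hd1 : 1 ≤ d := by
    by_contra hd0
    have hd0 : d = 0 := by omega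
    have hconst : ∀ i, ∃ c, ∀ ω y, T.answer (D.encode ω) y i = c := by
      intro i
      have h0 := hqd i
      rw [hd0] at h0
      cases hq : T.query i with
      | output c => exact ⟨c, fun ω y => by rw [Trees.answer, hq]; rfl⟩
      | probe a next => rw [hq, DecisionTree.depth] at h0; omega
    choose c hc using hconst
    simp only [hc] at herr'
    have : ∑ _i : Fin k, bal ≤ k * ε := (sum_le_sum fun i _ => by
      rw [hcoord i fun x y => if g x y = some (!(c i)) then 1 else 0]
      exact hbal _).trans herr'
    simp only [sum_const, card_univ, Fintype.card_fin, nsmul_eq_mul] at this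
    have := le_of_mul_le_mul_left this (by linarith)
    linarith
  have hd1' : (1 : ℝ) ≤ d := by exact_mod_cast hd1
  have hQ : (1 : ℝ) ≤ d * w := one_le_mul_of_one_le_of_one_le hd1' hw'
  have hL : (⌊n * tu⌋₊ * w : ℝ) < ε ^ 2 / 12960 * k := by
    have h1 : (⌊n * tu⌋₊ : ℝ) ≤ n * tu := Nat.floor_le htu0
    calc (⌊n * tu⌋₊ * w : ℝ) ≤ tu * n * w := by rw [mul_comm tu]; gcongr
      _ < ε ^ 2 / 12960 * ((k : ℝ) / w) * w := mul_lt_mul_of_pos_right htu (by linarith)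
      _ = _ := by field_simp
  have hmono : ∀ b, bal / (32 * Real.exp (256 * (d * w) / bal)) ≤
      maxMono μ (16 * (ε / bal)) g b := by
    intro b
    obtain ⟨S, B, hSB⟩ := exists_monochromatic_of_answers hk ha ha1 hν hν1 hρ_def
      (fun i ω => P i (D.encode ω)) (fun y ω => C y (D.encode ω)) (fun i p y v => R i p (W y v)) g
      hε (by linarith) hεbal hQ (log_card_transcripts d w).le (log_card_transcripts _ w).le hL
      (by simpa only [hans] using herr') b (hbal b)
    exact le_maxMono_of_sum hμ hε hbal0 (Real.exp_pos _) hSB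
  calc bal * corruptionBound μ (16 * (ε / bal)) g ≤
        bal * Real.logb 2 (1 / (bal / (32 * Real.exp (256 * (d * w) / bal)))) :=
        mul_le_mul_of_nonneg_left (corruptionBound_le (by positivity) hmono) hbal0.le
    _ ≤ 400 * (d * w) := mul_logb_le hbal0 hbal1 hQ
    _ ≤ 400 * (tq * w) := by
        have := Nat.floor_le htq
        gcongr

end Multiphase

end

open Multiphase
theorem mainTheorem1 :
    ∃ c C : ℝ, 0 < c ∧ 0 < C ∧
      ∀ ε α : ℝ, 0 < ε → 2 * ε ≤ α →
        ∃ c₁ : ℝ, 0 < c₁ ∧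
          ∀ (n k w s u : ℕ) (tu tq lam εt αt : ℝ)
            (f : Bits n → Bits n → Option Bool) (μ : PMF (Bits n × Bits n)),
            1 ≤ k → 1 ≤ w → 0 ≤ lam → 0 ≤ εt → 0 ≤ αt →
            ε = εt + lam → α = αt - lam →
            IsProductDist μ → IsBalanced μ f αt →
            ∀ D : RandomizedScheme f k w s u tu tq εt, D.SemiAdaptive →
              c₁ * ((k : ℝ) / w) ≤ tu * n ∨
              c * (α * smoothCorruptionBound μ (C * (ε / α)) lam f) ≤ tq * w := by
  refine ⟨1 / 400, 16, by norm_num, by norm_num, fun ε α hε hα =>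
    ⟨ε ^ 2 / 12960, by positivity, ?_⟩⟩
  intro n k w s u tu tq lam εt αt f μ hk hw hlam hεt _ hεl hαl hμ hf D hD
  refine or_iff_not_imp_left.2 fun htu => ?_
  have hα0 : 0 < α := by linarith
  have hscb : smoothCorruptionBound μ (16 * (ε / α)) lam f ≤ 400 * (tq * w) / α := by
    -- f is close to itself, so the supremum is over a nonempty set.
    refine csSup_le ⟨_, f, by simpa [IsClose, prob] using hlam, rfl⟩ ?_
    rintro _ ⟨g, hg, rfl⟩
    rw [le_div_iff₀' hα0]
    exact D.mul_corruptionBound_le hk hw hεt hε hεl hα hμ (by rw [hαl]; simpa using hf) hg hD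
      (not_le.1 htu)
  rw [le_div_iff₀' hα0] at hscb
  linarith
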